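/- **Setting.** Let $(M,\mu)$ be a probability space of tasks. Each $m\in M$ is a Markov decision process on a common measurable state space $X$ and a common finite nonempty action set $A$, with initial law $P^{(m)}(x_0)$, transition kernel $P^{(m)}(\cdot\mid x,a)$, reward $r^{(m)}(x,a)$, discount factor $\gamma\in[0,1]$ and last time index $H^{(m)}\in\mathbb N\cup\{\infty\}$ of a trajectory (everything depends measurably on $m,x,a$). Assume that $\gamma<1$ or that $\sup_m H^{(m)}<\infty$. Let $\phi_{x,a}\in\mathbb R^d$ and $\psi_{x,m}\in\mathbb R^{d+z}$ be measurable features, let $\alpha_\theta,\alpha_\beta>0$ be temperatures and let $K$ be the number of hyperplanes. The parameter is $\Omega=[\mathrm{vec}\,\Theta,\mathrm{vec}\,\beta]$ with $\Theta\in\mathbb R^{d\times 2^K}$ and $\beta\in\mathbb R^{(d+z)\times K}$. The skills are the binary vectors $i=(i_1,\dots,i_K)\in\{0,1\}^K$, with columns $\theta_i$ of $\Theta$. Put $$p_k(1\mid x,m)=\frac1{1+e^{-\alpha_\beta\psi_{x,m}^T\beta_k}},\quad p_k(0\mid x,m)=1-p_k(1\mid x,m),\quad p_\beta(i\mid x,m)=\prod_{k=1}^K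 p_k(i_k\mid x,m),$$ $$\sigma_{\theta_i}(a\mid x)=\frac{e^{\alpha_\theta\phi_{x,a}^T\theta_i}}{\sum_{b\in A}e^{\alpha_\theta\phi_{x,b}^T\theta_i}},\qquad \pi_\Omega(a\mid x,m)=\sum_i p_\beta(i\mid x,m)\,\sigma_{\theta_i}(a\mid x)\quad\text{(the ASAP policy)}.$$ Let $P^{(m)}_\Omega$ be the law of the generalized trajectory $g=(x_t,i_t,a_t)_t$ with $x_0\sim P^{(m)}(x_0)$, $(i_t,a_t)\sim p_\beta(i\mid x_t,m)\sigma_{\theta_i}(a\mid x_t)$ and $x_{t+1}\sim P^{(m)}(\cdot\mid x_t,a_t)$. Let $R^{(m)}(g)=\sum_{t=0}^{H^{(m)}}\gamma^t r^{(m)}(x_t,a_t)$, $J^{(m)}(\pi_\Omega)=\mathbb E_{P^{(m)}_\Omega}[R^{(m)}]$, and let $\rho(\pi_\Omega)=\int J^{(m)}(\pi_\Omega)\,d\mu(m)$ be the ASAP objective. **Update directions.** A vector $G$ is an ASAP update direction at $\Omega$ if it is one of the following. 1. $G=\partial\rho(\pi_\Omega)/\partial\Omega$. 2. The ASAP gradient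 $G=\mathbb E_{\mu}\,\mathbb E_{P^{(m)}_\Omega}\big[\sum_{t=0}^{H^{(m)}}\nabla_\Omega Z^{(m)}_\Omega(x_t,i_t,a_t)\,R^{(m)}\big]$, where $Z_\Omega^{(m)}(x,i,a)=\log\big(p_\beta(i\mid x,m)\sigma_{\theta_i}(a\mid x)\big)$, provided that for $\mu$-almost every $m$ one has $H^{(m)}<\infty$ and each $\nabla_\Omega Z^{(m)}_\Omega(x_t,i_t,a_t)$, $t\le H^{(m)}$, is integrable. 3. (If $H^{(m)}=\infty$ for all $m$.) The policy gradient with a compatible function approximator, $$G=\int\!\int\sum_a\frac{\partial\pi_\Omega(a\mid x,m)}{\partial\Omega}J^{(m)}_w(x,a)\,d^{\pi_\Omega}_{(m)}(dx)\,d\mu(m),$$ provided that this integral converges. Here $d_{(m)}^{\pi_\Omega}=\sum_t\gamma^tP^{(m)}_\Omega(x_t\in\cdot)$, and $J_w$ is a function approximator with parameter $w$ that satisfies, at $w$, the compatibility condition $\frac{\partial J^{(m)}_w(x,a)}{\partial w}=\frac{1}{\pi_\Omega(a\mid x,m)}\frac{\partial \pi_\Omega(a\mid x,m)}{\partial\Omega}$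 for all $m,x,a$ and $$\int\!\int\sum_a\pi_\Omega(a\mid x,m)\big[Q^{\pi_\Omega}_{(m)}(x,a)-J^{(m)}_w(x,a)\big]\frac{\partial J^{(m)}_w(x,a)}{\partial w}\,d^{\pi_\Omega}_{(m)}(dx)\,d\mu(m)=0,$$ where $Q_{(m)}^{\pi_\Omega}$ is the discounted action-value function. **Theorem (Convergence of ASAP).** Let $\Omega_0$ be an arbitrary (possibly random) initial parameter, and let $(\Omega_k)_{k\ge0}$ satisfy almost surely $\Omega_{k+1}=\Omega_k+\eta_kG_k$ for every $k$, where $G_k$ is an ASAP update direction at $\Omega_k$. Assume that 1. the step sizes satisfy $\eta_k\ge0$, $\lim_{k\to\infty}\eta_k=0$ and $\sum_k\eta_k=\infty$; 2. the second derivative of the policy is bounded, i.e. $\sup_{\Omega,m,x,a}\|D^2_\Omega\pi_\Omega(a\mid x,m)\|<\infty$, and the rewards are bounded, i.e. $\sup_{m,x,a}|r^{(m)}(x,a)|<\infty$. Then $\Omega\mapsto\rho(\pi_\Omega)$ is differentiable and, almost surely, the sequence $\rho(\pi_{\Omega_k})$ converges and $$\lim_{k\to\infty}\frac{\partial\rho(\pi_{\Omega_k})}{\partial\Omega}=0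 .$$ -/

import Mathlib

open MeasureTheory ProbabilityTheory Filter Topology
open scoped Gradient ENNReal

noncomputable section

namespace ASAP

/-- A skill is identified with its binary vector `(b_1, …, b_K)`, so there are `2 ^ K` skills. -/
abbrev Skill (K : ℕ) : Type := Fin K → Bool

/-- Index set of the entries of `Ω = [vec Θ, vec β]`, where `Θ` is a `d × 2 ^ K` matrix (one column
per skill) and `β` is a `(d + z) × K` matrix (one column per hyperplane). -/
abbrev ParamIdx (d z K : ℕ) : Type := (Fin d × Skill K) ⊕ (Fin (d + z) × Fin K)

/-- The parameter space, with its Euclidean norm. -/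
abbrev Param (d z K : ℕ) : Type := EuclideanSpace ℝ (ParamIdx d z K)

/-- The column `θ_i` of `Θ`. -/
def thetaCol {d z K : ℕ} (Ω : Param d z K) (i : Skill K) : Fin d → ℝ :=
  fun j => Ω (Sum.inl (j, i))

/-- The column `β_k` of `β`. -/
def betaCol {d z K : ℕ} (Ω : Param d z K) (k : Fin K) : Fin (d + z) → ℝ :=
  fun j => Ω (Sum.inr (j, k))

/-- One step `(x_t, (i_t, a_t))` of a generalized trajectory: state, skill, action. The reward of
the step is a function of these and of the task. -/
abbrev Step (X A : Type*) (K : ℕ) := X × (Skill K × A)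

/-- A family of MDPs on the state space `X` and the action space `A`, indexed by `m : M`, together
with the features and temperatures that enter the ASAP policy. `horizon m` is the index of the
last step of a trajectory in task `m`; it is `⊤` in the infinite-horizon discounted formulation. -/
structure Model (M X A : Type*) [MeasurableSpace M] [MeasurableSpace X] [MeasurableSpace A]
    (d z K : ℕ) where
  /-- law of the initial state of task `m` -/
  init : Kernel M X
  init_markov : IsMarkovKernel init
  /-- transition probabilities `P^{(m)}(· | x, a)` -/
  trans : Kernel (M × X × A) X
  trans_markov : IsMarkovKernel trans
  /-- the reward function of task `m` -/
  reward : M → X → A → ℝ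
  measurable_reward : Measurable fun p : M × X × A => reward p.1 p.2.1 p.2.2
  γ : ℝ
  γ_nonneg : 0 ≤ γ
  γ_le_one : γ ≤ 1
  horizon : M → ℕ∞
  measurable_horizon : Measurable horizon
  /-- state-action features `φ_{x,a}` -/
  φ : X → A → Fin d → ℝ
  measurable_φ : Measurable fun p : X × A => φ p.1 p.2
  /-- hyperplane features `ψ_{x,m}` -/
  ψ : X → M → Fin (d + z) → ℝ
  measurable_ψ : Measurable fun p : X × M => ψ p.1 p.2
  /-- temperature of the intra-skill policies -/
  αθ : ℝ
  αθ_pos : 0 < αθ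
  /-- temperature of the hyperplanes -/
  αβ : ℝ
  αβ_pos : 0 < αβ

attribute [instance] Model.init_markov Model.trans_markov

namespace Model

variable {M X A : Type*} [MeasurableSpace M] [MeasurableSpace X] [MeasurableSpace A]
  {d z K : ℕ}

section Policy

variable (S : Model M X A d z K)

/-- `p_k(b_k = b | x, m)`. -/
def bitProb (Ω : Param d z K) (m : M) (x : X) (k : Fin K) (b : Bool) : ℝ :=
  if b then 1 / (1 + Real.exp (-S.αβ * (S.ψ x m ⬝ᵥ betaCol Ω k)))
  else 1 - 1 / (1 + Real.exp (-S.αβ * (S.ψ x m ⬝ᵥ betaCol Ω k)))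

/-- `p_β(i | x, m)`, the probability of executing skill `i`. -/
def skillProb (Ω : Param d z K) (m : M) (x : X) (i : Skill K) : ℝ :=
  ∏ k, S.bitProb Ω m x k (i k)

lemma bitProb_nonneg (Ω : Param d z K) (m : M) (x : X) (k : Fin K) (b : Bool) :
    0 ≤ S.bitProb Ω m x k b := by
  have h := Real.exp_pos (-S.αβ * (S.ψ x m ⬝ᵥ betaCol Ω k))
  unfold bitProb
  split_ifs
  · positivity
  · rw [sub_nonneg, div_le_one (by positivity)]
    linarith

lemma sum_skillProb (Ω : Param d z K) (m : M) (x : X) : ∑ i, S.skillProb Ω m x i = 1 := by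
  have h := Finset.prod_univ_sum (fun _ : Fin K => (Finset.univ : Finset Bool))
    (fun k b => S.bitProb Ω m x k b)
  rw [Fintype.piFinset_univ] at h
  unfold skillProb
  rw [← h]
  simp [bitProb]

lemma skillProb_nonneg (Ω : Param d z K) (m : M) (x : X) (i : Skill K) :
    0 ≤ S.skillProb Ω m x i :=
  Finset.prod_nonneg fun k _ => S.bitProb_nonneg Ω m x k (i k)

lemma measurable_bitProb (Ω : Param d z K) (m : M) (k : Fin K) (b : Bool) :
    Measurable fun x => S.bitProb Ω m x k b := by
  have h : Measurable fun x => S.ψ x m :=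
    S.measurable_ψ.comp (measurable_id.prodMk measurable_const)
  have h1 : Measurable fun x => S.ψ x m ⬝ᵥ betaCol Ω k := by
    unfold dotProduct
    exact Finset.measurable_sum _ fun j _ =>
      ((measurable_pi_apply j).comp h).mul_const _
  unfold bitProb
  split_ifs <;> fun_prop

variable [Fintype A]

/-- `σ_{θ_i}(a | x)`, the Gibbs intra-skill policy of skill `i`. -/
def intraSkill (Ω : Param d z K) (x : X) (i : Skill K) (a : A) : ℝ :=
  Real.exp (S.αθ * (S.φ x a ⬝ᵥ thetaCol Ω i)) /
    ∑ b, Real.exp (S.αθ * (S.φ x b ⬝ᵥ thetaCol Ω i))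

/-- The ASAP policy `π_Ω(a | x, m)`. -/
def policy (Ω : Param d z K) (m : M) (x : X) (a : A) : ℝ :=
  ∑ i, S.skillProb Ω m x i * S.intraSkill Ω x i a

/-- `Z_Ω^{(m)}(x, i, a) = log (p_β(i | x, m) σ_{θ_i}(a | x))`. -/
def logLik (Ω : Param d z K) (m : M) (s : Step X A K) : ℝ :=
  Real.log (S.skillProb Ω m s.1 s.2.1 * S.intraSkill Ω s.1 s.2.1 s.2.2)

lemma intraSkill_nonneg (Ω : Param d z K) (x : X) (i : Skill K) (a : A) :
    0 ≤ S.intraSkill Ω x i a := by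
  unfold intraSkill
  positivity

lemma sum_intraSkill [Nonempty A] (Ω : Param d z K) (x : X) (i : Skill K) :
    ∑ a, S.intraSkill Ω x i a = 1 := by
  unfold intraSkill
  rw [← Finset.sum_div]
  exact div_self (Finset.sum_pos (fun b _ => Real.exp_pos _) Finset.univ_nonempty).ne'

lemma measurable_intraSkill (Ω : Param d z K) (i : Skill K) (a : A) :
    Measurable fun x => S.intraSkill Ω x i a := by
  have h (b : A) : Measurable fun x => S.φ x b ⬝ᵥ thetaCol Ω i := by
    have h0 : Measurable fun x => S.φ x b :=
      S.measurable_φ.comp (measurable_id.prodMk measurable_const)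
    unfold dotProduct
    exact Finset.measurable_sum _ fun j _ =>
      ((measurable_pi_apply j).comp h0).mul_const _
  unfold intraSkill
  exact (((h a).const_mul _).exp).div
    (Finset.measurable_sum _ fun b _ => ((h b).const_mul _).exp)

/-- The joint law of `(i_t, a_t)` given `x_t = x` in task `m`: the pair `(i, a)` has probability
`p_β(i | x, m) σ_{θ_i}(a | x)`. -/
def choiceKernel (Ω : Param d z K) (m : M) : Kernel X (Skill K × A) where
  toFun x := ∑ ia : Skill K × A,
    ENNReal.ofReal (S.skillProb Ω m x ia.1 * S.intraSkill Ω x ia.1 ia.2) • Measure.dirac ia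
  measurable' := by
    refine Measure.measurable_of_measurable_coe _ fun s _ => ?_
    simp only [Measure.finsetSum_apply, Measure.smul_apply, smul_eq_mul]
    refine Finset.measurable_sum _ fun ia _ => Measurable.mul_const ?_ _
    refine ENNReal.measurable_ofReal.comp (Measurable.mul ?_ (S.measurable_intraSkill Ω _ _))
    exact Finset.measurable_prod _ fun k _ => S.measurable_bitProb Ω m k _

instance [Nonempty A] (Ω : Param d z K) (m : M) : IsMarkovKernel (S.choiceKernel Ω m) := by
  refine ⟨fun x => ⟨?_⟩⟩
  simp only [choiceKernel, Kernel.coe_mk, Measure.finsetSum_apply, Measure.smul_apply,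
    measure_univ, smul_eq_mul, mul_one]
  rw [← ENNReal.ofReal_sum_of_nonneg fun ia _ =>
    mul_nonneg (S.skillProb_nonneg Ω m x _) (S.intraSkill_nonneg Ω x _ _)]
  rw [Fintype.sum_prod_type]
  simp [← Finset.mul_sum, sum_intraSkill, sum_skillProb]

/-- One step of a generalized trajectory in task `m`: from `(x_t, i_t, a_t)` draw
`x_{t+1} ∼ P^{(m)}(· | x_t, a_t)`, then `(i_{t+1}, a_{t+1})` given `x_{t+1}`. -/
def stepKernel (Ω : Param d z K) (m : M) : Kernel (Step X A K) (Step X A K) :=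
  (S.trans.comap (fun s : Step X A K => (m, s.1, s.2.2)) (by fun_prop)) ⊗ₖ
    Kernel.prodMkLeft (Step X A K) (S.choiceKernel Ω m)

instance [Nonempty A] (Ω : Param d z K) (m : M) : IsMarkovKernel (S.stepKernel Ω m) := by
  unfold stepKernel
  infer_instance

/-- The law of generalized trajectories `(x_t, i_t, a_t)_t` in task `m` under `π_Ω`, for an
initial state distributed as `ν`. (Only the steps `t ≤ horizon m` are used.) -/
def trajLawFrom [Nonempty A] (Ω : Param d z K) (m : M) (ν : Measure X) :
    Measure (ℕ → Step X A K) :=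
  Kernel.trajMeasure (X := fun _ => Step X A K) (ν ⊗ₘ S.choiceKernel Ω m) fun n =>
    (S.stepKernel Ω m).comap
      (fun h : (i : Finset.Iic n) → Step X A K => h ⟨n, Finset.mem_Iic.2 le_rfl⟩)
      (measurable_pi_apply _)

/-- `P_Ω^{(m)}`, the law of generalized trajectories in task `m`. -/
def trajLaw [Nonempty A] (Ω : Param d z K) (m : M) : Measure (ℕ → Step X A K) :=
  S.trajLawFrom Ω m (S.init m)

end Policy

variable (S : Model M X A d z K)

open Classical in
/-- The discounted cumulative reward `R^{(m)}(g) = ∑_{t = 0}^{horizon m} γ ^ t r_t`. -/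
def ret (m : M) (g : ℕ → Step X A K) : ℝ :=
  ∑' t : ℕ, if (t : ℕ∞) ≤ S.horizon m then S.γ ^ t * S.reward m (g t).1 (g t).2.2 else 0

variable [Fintype A] [Nonempty A]

/-- The expected return `J^{(m)}(π_Ω)`. -/
def expReturn (Ω : Param d z K) (m : M) : ℝ := ∫ g, S.ret m g ∂S.trajLaw Ω m

/-- The ASAP objective `ρ(π_Ω) = ∫ μ(m) J^{(m)}(π_Ω) dm`. -/
def objective (μ : Measure M) (Ω : Param d z K) : ℝ := ∫ m, S.expReturn Ω m ∂μ

/-- The ASAP gradient `E_μ [E_{P_Ω^{(m)}} [(∑_{t = 0}^{H} ∇_Ω Z_Ω^{(m)}(x_t, i_t, a_t)) R^{(m)}]]`,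
with `H = horizon m`, for finite horizons. -/
def asapGradient (μ : Measure M) (Ω : Param d z K) : Param d z K :=
  ∫ m, ∫ g, S.ret m g •
    ∑ t ∈ Finset.range ((S.horizon m).toNat + 1), ∇ (fun Ω' => S.logLik Ω' m (g t)) Ω
      ∂S.trajLaw Ω m ∂μ

/-- The ASAP gradient is well defined at `Ω`: horizons are finite, and the vectors
`∇_Ω Z_Ω^{(m)}(x_t, i_t, a_t)` have finite expectation. -/
def HasASAPGradient (μ : Measure M) (Ω : Param d z K) : Prop :=
  ∀ᵐ m ∂μ, S.horizon m ≠ ⊤ ∧ ∀ t : ℕ, (t : ℕ∞) ≤ S.horizon m →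
    Integrable (fun g => ∇ (fun Ω' => S.logLik Ω' m (g t)) Ω) (S.trajLaw Ω m)

/-- The value function `V_{(m)}^{π_Ω}`. -/
def value (Ω : Param d z K) (m : M) (x : X) : ℝ :=
  ∫ g, S.ret m g ∂S.trajLawFrom Ω m (Measure.dirac x)

/-- The action-value function `Q_{(m)}^{π_Ω}` (infinite horizon). -/
def actionValue (Ω : Param d z K) (m : M) (x : X) (a : A) : ℝ :=
  S.reward m x a + S.γ * ∫ y, S.value Ω m y ∂S.trans (m, x, a)

/-- The discounted weighting of states `d_{(m)}^{π_Ω} = ∑_t γ ^ t P^{(m)}(x_t ∈ ·)`. -/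
def occupancy (Ω : Param d z K) (m : M) : Measure X :=
  Measure.sum fun t : ℕ =>
    ENNReal.ofReal (S.γ ^ t) • (S.trajLaw Ω m).map fun g => (g t).1

/-- `∑_m μ(m) ∑_x d_{(m)}^{π_Ω}(x) F(m, x)`. -/
def occSum {E : Type*} [NormedAddCommGroup E] [NormedSpace ℝ E] (μ : Measure M)
    (Ω : Param d z K) (F : M → X → E) : E :=
  ∫ m, ∫ x, F m x ∂S.occupancy Ω m ∂μ

/-- The sum `∑_m μ(m) ∑_x d_{(m)}^{π_Ω}(x) F(m, x)` is well defined. -/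
def OccIntegrable {E : Type*} [NormedAddCommGroup E] [NormedSpace ℝ E] (μ : Measure M)
    (Ω : Param d z K) (F : M → X → E) : Prop :=
  (∀ᵐ m ∂μ, Integrable (F m) (S.occupancy Ω m)) ∧
    Integrable (fun m => ∫ x, F m x ∂S.occupancy Ω m) μ

/-- `∑_a ∂π_Ω(a | x, m)/∂Ω f(m, x, a)`. -/
def policyGradTerm (Ω : Param d z K) (f : M → X → A → ℝ) (m : M) (x : X) : Param d z K :=
  ∑ a, f m x a • ∇ (fun Ω' => S.policy Ω' m x a) Ω

/-- A function approximator `w' ↦ J_{w'}^{(m)}(x, a)` (written `f w' m x a`) with the parameter `w`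
is admissible at `Ω`: it satisfies the compatibility condition
`∂J_w/∂w = (∂π_Ω/∂Ω) / π_Ω`, the sum that defines the resulting policy gradient is well defined,
and `w` satisfies the stationarity condition
`∑_m μ(m) ∑_x d(x) ∑_a π_Ω(a | x, m) [Q(x, a) - J_w(x, a)] ∂J_w(x, a)/∂w = 0`. -/
structure IsCompatibleFit (μ : Measure M) (Ω : Param d z K)
    (f : Param d z K → M → X → A → ℝ) (w : Param d z K) : Prop where
  compatible : ∀ m x a, HasGradientAt (fun w' => f w' m x a)
    ((S.policy Ω m x a)⁻¹ • ∇ (fun Ω' => S.policy Ω' m x a) Ω) w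
  integrable : S.OccIntegrable μ Ω (S.policyGradTerm Ω (f w))
  stationary : S.occSum μ Ω (fun m x => ∑ a,
    (S.policy Ω m x a * (S.actionValue Ω m x a - f w m x a)) • ∇ (fun w' => f w' m x a) w) = 0

/-- `G` is an admissible ASAP update direction at `Ω`: the gradient `∂ρ(π_Ω)/∂Ω` itself, the ASAP
gradient (finite horizon), or the policy gradient formed with a compatible function
approximator (infinite horizon). -/
inductive IsUpdateDirection (μ : Measure M) (Ω : Param d z K) : Param d z K → Prop
  | exact : IsUpdateDirection μ Ω (∇ (S.objective μ) Ω)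
  | likelihoodRatio (h : S.HasASAPGradient μ Ω) : IsUpdateDirection μ Ω (S.asapGradient μ Ω)
  | approx (hH : ∀ m, S.horizon m = ⊤) (f : Param d z K → M → X → A → ℝ) (w : Param d z K)
      (hf : S.IsCompatibleFit μ Ω f w) :
      IsUpdateDirection μ Ω (S.occSum μ Ω (S.policyGradTerm Ω (f w)))

end Model

end ASAP

end

/-! Every admissible update direction equals the exact gradient of ρ, so each sample path is a
deterministic gradient ascent. It remains to see that ρ is bounded with Lipschitz gradient, and that
ascent with vanishing, non-summable steps behaves as claimed on such a function.

Smoothness: a [0,1]-valued function with B-Lipschitz gradient has gradient at most 1 + B, so the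
bound on the second derivative of the policy also controls the first. The reward expected t steps
later arises from repeated averaging against the policy. As the weights sum to one, its size does
not grow, its gradient grows like t and the Lipschitz constant of the gradient like t²
(`Bounds.isC11_futureReward`). The horizon weights are summable against (t + 1)², so the bounds
survive summation over time and averaging over tasks (`Bounds.isC11_objective`).

Gradients: differentiating the averaging recursion peels off one decision at a time, and the
derivative of the reward at time t becomes a sum over decision times j ≤ t
(`Bounds.gradient_expReturn`). The ASAP gradient gives the same sum, because averaging the score
yields the derivative of the policy and the score is uncorrelated with earlier rewards. For a
compatible approximator, stationarity says that replacing Q by J_w does not change the integral;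
with Q, the integral is the same double sum regrouped along t = j + k.

Ascent (`gradient_ascent_converges`): late steps raise f by at least η‖∇f‖²/2, so the values
converge. If the gradient norm were at least ε at a late time, non-summability would later force it
below ε/2; but the path in between has length at most 4/ε times the small gain in f, too short for a
Lipschitz gradient to change that much. -/

noncomputable section

namespace ASAP

/-! ### Taylor estimates and convergence of gradient ascent. -/

section Calculus

variable {E : Type*} [NormedAddCommGroup E] [InnerProductSpace ℝ E]

section Complete

variable [CompleteSpace E]

lemma hasGradientAt_sum_mul {ι : Type*} (s : Finset ι) {p q : ι → E → ℝ} {x : E}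
    (hp : ∀ i ∈ s, DifferentiableAt ℝ (p i) x) (hq : ∀ i ∈ s, DifferentiableAt ℝ (q i) x) :
    HasGradientAt (fun y => ∑ i ∈ s, p i y * q i y)
      (∑ i ∈ s, (p i x • ∇ (q i) x + q i x • ∇ (p i) x)) x := by
  rw [hasGradientAt_iff_hasFDerivAt]
  simp only [map_sum, map_add, map_smul, toDual_gradient]
  exact HasFDerivAt.fun_sum fun i hi => (hp i hi).hasFDerivAt.mul (hq i hi).hasFDerivAt

lemma norm_gradient (f : E → ℝ) (x : E) : ‖∇ f x‖ = ‖fderiv ℝ f x‖ := by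
  rw [← toDual_gradient, LinearIsometryEquiv.norm_map]

lemma norm_gradient_sub (f g : E → ℝ) (x y : E) :
    ‖∇ f x - ∇ g y‖ = ‖fderiv ℝ f x - fderiv ℝ g y‖ := by
  rw [← toDual_gradient, ← toDual_gradient, ← map_sub, LinearIsometryEquiv.norm_map]

lemma gradient_const_mul {f : E → ℝ} {x : E} (hf : DifferentiableAt ℝ f x) (c : ℝ) :
    ∇ (fun y => c * f y) x = c • ∇ f x := by
  refine HasGradientAt.gradient ?_
  rw [hasGradientAt_iff_hasFDerivAt, map_smul, toDual_gradient]
  exact hf.hasFDerivAt.const_mul c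

lemma abs_sub_le_of_norm_gradient_le {f : E → ℝ} {C : ℝ} (hf : Differentiable ℝ f)
    (hC : ∀ x, ‖∇ f x‖ ≤ C) (x y : E) : |f x - f y| ≤ C * ‖x - y‖ := by
  have := Convex.norm_image_sub_le_of_norm_fderiv_le (𝕜 := ℝ) (f := f) (C := C) (s := Set.univ)
    (x := y) (y := x) (fun z _ => hf z) (fun z _ => by rw [← norm_gradient]; exact hC z)
    convex_univ trivial trivial
  simpa using this

/-- A first-order Taylor estimate for functions with Lipschitz gradient. -/
lemma abs_taylor_le {f : E → ℝ} {c : ℝ} (hf : Differentiable ℝ f)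
    (hc : ∀ x y, ‖∇ f x - ∇ f y‖ ≤ c * ‖x - y‖) (x v : E) :
    |f (x + v) - f x - inner ℝ (∇ f x) v| ≤ c * ‖v‖ ^ 2 := by
  rcases eq_or_ne v 0 with rfl | hv
  · simp
  have hc0 : 0 ≤ c := by
    have h := (norm_nonneg _).trans (hc v 0)
    rw [sub_zero] at h
    exact nonneg_of_mul_nonneg_left h (norm_pos_iff.2 hv)
  -- On the ball of radius ‖v‖ the derivative deviates from its value at x by at most c‖v‖. This
  -- gives the constant c instead of the sharp c/2, which is enough.
  have h := Convex.norm_image_sub_le_of_norm_fderiv_le' (𝕜 := ℝ) (f := f) (C := c * ‖v‖)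
    (φ := fderiv ℝ f x) (s := Metric.closedBall x ‖v‖) (x := x) (y := x + v)
    (fun z _ => hf z) (fun z hz => by
      rw [← norm_gradient_sub]
      refine (hc z x).trans (mul_le_mul_of_nonneg_left ?_ hc0)
      simpa [dist_eq_norm] using hz)
    (convex_closedBall _ _) (by simp) (by simp)
  rw [← inner_gradient_left] at h
  simpa [pow_two, mul_assoc] using h

/-- A unit step along the gradient raises f by at least ‖∇f x‖ - c, while values in [0, 1] leave
room for a rise of at most 1. -/
lemma norm_gradient_le_of_lipschitz {f : E → ℝ} {c : ℝ} (hc0 : 0 ≤ c) (hf : Differentiable ℝ f)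
    (h0 : ∀ x, 0 ≤ f x) (h1 : ∀ x, f x ≤ 1)
    (hc : ∀ x y, ‖∇ f x - ∇ f y‖ ≤ c * ‖x - y‖) (x : E) : ‖∇ f x‖ ≤ 1 + c := by
  rcases eq_or_ne (∇ f x) 0 with h | h
  · rw [h, norm_zero]
    positivity
  · have hn : ‖∇ f x‖ ≠ 0 := norm_ne_zero_iff.2 h
    have key := abs_taylor_le hf hc x (‖∇ f x‖⁻¹ • ∇ f x)
    rw [real_inner_smul_right, real_inner_self_eq_norm_sq, norm_smul, norm_inv, norm_norm,
      inv_mul_cancel₀ hn, one_pow, mul_one, pow_two, inv_mul_cancel_left₀ hn] at key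
    have := (abs_le.1 key).1
    linarith [h0 x, h1 (x + ‖∇ f x‖⁻¹ • ∇ f x)]

lemma norm_gradient_sub_le_of_iteratedFDeriv_two {f : E → ℝ} {B : ℝ} (hf : ContDiff ℝ 2 f)
    (hB : ∀ x, ‖iteratedFDeriv ℝ 2 f x‖ ≤ B) (x y : E) : ‖∇ f x - ∇ f y‖ ≤ B * ‖x - y‖ := by
  rw [norm_gradient_sub]
  have hd : Differentiable ℝ (fderiv ℝ f) :=
    (hf.fderiv_right (m := 1) (by norm_num)).differentiable (by norm_num)
  refine Convex.norm_image_sub_le_of_norm_fderiv_le (𝕜 := ℝ) (s := Set.univ)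
    (fun z _ => hd z) (fun z _ => ?_) convex_univ trivial trivial
  have h := norm_iteratedFDeriv_fderiv (𝕜 := ℝ) (f := f) (n := 1) (x := z)
  rw [norm_iteratedFDeriv_one] at h
  rw [h]
  exact hB z

/-- Gradient ascent with vanishing, non-summable steps: one trajectory. -/
theorem gradient_ascent_converges {f : E → ℝ} {b c : ℝ} (hc0 : 0 ≤ c) (hf : Differentiable ℝ f)
    (hb : ∀ x, f x ≤ b) (hc : ∀ x y, ‖∇ f x - ∇ f y‖ ≤ c * ‖x - y‖)
    {η : ℕ → ℝ} (hη_nonneg : ∀ k, 0 ≤ η k) (hη_lim : Tendsto η atTop (𝓝 0))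
    (hη_sum : Tendsto (fun n => ∑ k ∈ Finset.range n, η k) atTop atTop)
    {x : ℕ → E} (hx : ∀ k, x (k + 1) = x k + η k • ∇ f (x k)) :
    (∃ l : ℝ, Tendsto (fun k => f (x k)) atTop (𝓝 l)) ∧
      Tendsto (fun k => ∇ f (x k)) atTop (𝓝 0) := by
  -- From here on the quadratic Taylor error consumes at most half of the first-order gain.
  obtain ⟨N, hN⟩ : ∃ N, ∀ k ≥ N, c * η k ≤ 1 / 2 := by
    have h : Tendsto (fun k => c * η k) atTop (𝓝 0) := by simpa using hη_lim.const_mul c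
    exact eventually_atTop.1 (h.eventually (ge_mem_nhds (by norm_num)))
  have hstep : ∀ k ≥ N, η k * ‖∇ f (x k)‖ ^ 2 ≤ 2 * (f (x (k + 1)) - f (x k)) := by
    intro k hk
    have key := abs_taylor_le hf hc (x k) (η k • ∇ f (x k))
    rw [← hx, real_inner_smul_right, real_inner_self_eq_norm_sq, norm_smul, Real.norm_eq_abs,
      abs_of_nonneg (hη_nonneg k)] at key
    have h1 := (abs_le.1 key).1
    have h2 : c * η k * (η k * ‖∇ f (x k)‖ ^ 2) ≤ 1 / 2 * (η k * ‖∇ f (x k)‖ ^ 2) :=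
      mul_le_mul_of_nonneg_right (hN k hk) (mul_nonneg (hη_nonneg k) (by positivity))
    nlinarith
  have hmono : ∀ k ≥ N, f (x k) ≤ f (x (k + 1)) := fun k hk => by
    have := hstep k hk
    have := mul_nonneg (hη_nonneg k) (sq_nonneg ‖∇ f (x k)‖)
    linarith
  have hconv : ∃ l : ℝ, Tendsto (fun k => f (x k)) atTop (𝓝 l) := by
    have hm : Monotone fun k => f (x (k + N)) := monotone_nat_of_le_succ fun k => by
      have := hmono (k + N) (by omega)
      rwa [show k + 1 + N = k + N + 1 by ring]
    exact ⟨_, (tendsto_add_atTop_iff_nat N).1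
      (tendsto_atTop_ciSup hm ⟨b, by rintro _ ⟨k, rfl⟩; exact hb _⟩)⟩
  refine ⟨hconv, ?_⟩
  obtain ⟨l, hl⟩ := hconv
  have hle : ∀ k ≥ N, f (x k) ≤ l := fun k hk => by
    have hm : ∀ n ≥ k, f (x k) ≤ f (x n) := fun n hn => by
      induction n, hn using Nat.le_induction with
      | base => exact le_rfl
      | succ n hn ih => exact ih.trans (hmono n (by omega))
    exact ge_of_tendsto hl (eventually_atTop.2 ⟨k, hm⟩)
  rw [tendsto_zero_iff_norm_tendsto_zero, Metric.tendsto_atTop]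
  intro ε hε
  -- δ will bound the gain in f still available: over a path of length 4/ε * δ the gradient changes
  -- by less than ε/2. The c + 1 in the denominator allows c = 0.
  obtain ⟨δ, hδ, hcδ⟩ : ∃ δ > 0, c * (4 / ε * δ) < ε / 2 := by
    refine ⟨ε ^ 2 / (8 * (c + 1)), by positivity, ?_⟩
    rw [show c * (4 / ε * (ε ^ 2 / (8 * (c + 1)))) = ε / 2 * (c / (c + 1)) by
      field_simp; ring]
    exact mul_lt_of_lt_one_right (by positivity) ((div_lt_one (by positivity)).2 (by linarith))
  obtain ⟨N', hN'⟩ := eventually_atTop.1 (hl.eventually (lt_mem_nhds (show l - δ < l by linarith)))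
  refine ⟨max N N', fun k hk => ?_⟩
  have hkN : N ≤ k := (le_max_left _ _).trans hk
  rw [dist_zero_right, norm_norm]
  by_contra! hkε
  -- While the gradient norm stays at least ε/2, dividing the ascent inequality by it once bounds
  -- the path length, and twice the accumulated step size, by the gain in f.
  have hpot : ∀ n ≥ k, (∀ j, k ≤ j → j < n → ε / 2 ≤ ‖∇ f (x j)‖) →
      ‖x k - x n‖ ≤ 4 / ε * (f (x n) - f (x k)) ∧
      (∑ j ∈ Finset.range n, η j - ∑ j ∈ Finset.range k, η j) ≤
        8 / ε ^ 2 * (f (x n) - f (x k)) := by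
    intro n hn
    induction n, hn using Nat.le_induction with
    | base => intro _; simp
    | succ n hn ih =>
      intro hj
      obtain ⟨h1, h2⟩ := ih fun j hj1 hj2 => hj j hj1 (by omega)
      have ha := hj n hn (by omega)
      have hs := hstep n (by omega)
      have hstep1 : η n * ‖∇ f (x n)‖ ≤ 4 / ε * (f (x (n + 1)) - f (x n)) := by
        rw [div_mul_eq_mul_div, le_div_iff₀ hε]
        have := mul_le_mul_of_nonneg_left ha (mul_nonneg (hη_nonneg n) (norm_nonneg (∇ f (x n))))
        nlinarith
      have hstep2 : η n ≤ 8 / ε ^ 2 * (f (x (n + 1)) - f (x n)) := by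
        rw [div_mul_eq_mul_div, le_div_iff₀ (by positivity)]
        have := mul_le_mul_of_nonneg_left (pow_le_pow_left₀ (by positivity) ha 2) (hη_nonneg n)
        nlinarith
      constructor
      · calc ‖x k - x (n + 1)‖ ≤ ‖x k - x n‖ + ‖x n - x (n + 1)‖ :=
            norm_sub_le_norm_sub_add_norm_sub _ _ _
          _ = ‖x k - x n‖ + η n * ‖∇ f (x n)‖ := by
            rw [hx, sub_add_cancel_left, norm_neg, norm_smul, Real.norm_eq_abs,
              abs_of_nonneg (hη_nonneg n)]
          _ ≤ 4 / ε * (f (x n) - f (x k)) + 4 / ε * (f (x (n + 1)) - f (x n)) :=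
            add_le_add h1 hstep1
          _ = _ := by ring
      · rw [Finset.sum_range_succ]
        calc _ = (∑ j ∈ Finset.range n, η j - ∑ j ∈ Finset.range k, η j) + η n := by ring
          _ ≤ 8 / ε ^ 2 * (f (x n) - f (x k)) + 8 / ε ^ 2 * (f (x (n + 1)) - f (x n)) :=
            add_le_add h2 hstep2
          _ = _ := by ring
  have hgap : ∀ n ≥ k, f (x n) - f (x k) ≤ δ := fun n hn => by
    have h1 := hle n (by omega)
    have h2 := hN' k ((le_max_right _ _).trans hk)
    linarith
  -- Otherwise the step sizes after time k would have a finite sum.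
  have hex : ∃ n, k ≤ n ∧ ‖∇ f (x n)‖ < ε / 2 := by
    by_contra! hcon
    obtain ⟨n, hn⟩ := ((hη_sum.eventually (eventually_gt_atTop
      (∑ j ∈ Finset.range k, η j + 8 / ε ^ 2 * δ))).and (eventually_ge_atTop k)).exists
    have h1 := (hpot n hn.2 fun j hj _ => hcon j hj).2
    have h2 := mul_le_mul_of_nonneg_left (hgap n hn.2) (show 0 ≤ 8 / ε ^ 2 by positivity)
    linarith [hn.1]
  classical
  -- At the first such time the path bound still applies, and the drop from ε to below ε/2
  -- contradicts the choice of δ.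
  obtain ⟨hn1, hn2⟩ := Nat.find_spec hex
  have h1 := (hpot _ hn1 fun j hj hjn => not_lt.1 fun hlt => Nat.find_min hex hjn ⟨hj, hlt⟩).1
  have h2 := hc (x k) (x (Nat.find hex))
  have h3 := mul_le_mul_of_nonneg_left (h1.trans
    (mul_le_mul_of_nonneg_left (hgap _ hn1) (show 0 ≤ 4 / ε by positivity))) hc0
  have h4 := norm_sub_norm_le (∇ f (x k)) (∇ f (x (Nat.find hex)))
  linarith

/-! ### Stability of bounds on a function and its gradient under mixtures. -/

/-- Bounded functions with bounded and Lipschitz gradient, with explicit constants. -/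
structure IsC11 (c₀ c₁ c₂ : ℝ) (f : E → ℝ) : Prop where
  differentiable : Differentiable ℝ f
  abs_le : ∀ x, |f x| ≤ c₀
  norm_gradient_le : ∀ x, ‖∇ f x‖ ≤ c₁
  gradient_lipschitz : ∀ x y, ‖∇ f x - ∇ f y‖ ≤ c₂ * ‖x - y‖

namespace IsC11

variable {c₀ c₁ c₂ : ℝ} {f : E → ℝ}

lemma nonneg₀ (h : IsC11 c₀ c₁ c₂ f) : 0 ≤ c₀ := (abs_nonneg _).trans (h.abs_le 0)

lemma nonneg₁ (h : IsC11 c₀ c₁ c₂ f) : 0 ≤ c₁ := (norm_nonneg _).trans (h.norm_gradient_le 0)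

lemma mono (h : IsC11 c₀ c₁ c₂ f) {d₀ d₁ d₂ : ℝ} (h₀ : c₀ ≤ d₀) (h₁ : c₁ ≤ d₁) (h₂ : c₂ ≤ d₂) :
    IsC11 d₀ d₁ d₂ f where
  differentiable := h.differentiable
  abs_le x := (h.abs_le x).trans h₀
  norm_gradient_le x := (h.norm_gradient_le x).trans h₁
  gradient_lipschitz x y := (h.gradient_lipschitz x y).trans (by gcongr)

lemma const {c b : ℝ} (h : |c| ≤ b) : IsC11 b 0 0 fun _ : E => c where
  differentiable := differentiable_const c
  abs_le _ := h
  norm_gradient_le x := by simp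
  gradient_lipschitz x y := by simp

lemma const_mul (h : IsC11 c₀ c₁ c₂ f) (c : ℝ) :
    IsC11 (|c| * c₀) (|c| * c₁) (|c| * c₂) fun x => c * f x where
  differentiable := h.differentiable.const_mul c
  abs_le x := by
    rw [abs_mul]
    exact mul_le_mul_of_nonneg_left (h.abs_le x) (abs_nonneg c)
  norm_gradient_le x := by
    rw [gradient_const_mul (h.differentiable x), norm_smul, Real.norm_eq_abs]
    exact mul_le_mul_of_nonneg_left (h.norm_gradient_le x) (abs_nonneg c)
  gradient_lipschitz x y := by
    rw [gradient_const_mul (h.differentiable x), gradient_const_mul (h.differentiable y),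
      ← smul_sub, norm_smul, Real.norm_eq_abs, mul_assoc]
    exact mul_le_mul_of_nonneg_left (h.gradient_lipschitz x y) (abs_nonneg c)

/-- Mixtures with parameter-dependent probability weights. -/
lemma mixture {A : Type*} [Fintype A] {p q : A → E → ℝ} {C : ℝ}
    (hp : ∀ a, IsC11 1 C C (p a)) (hp0 : ∀ a x, 0 ≤ p a x) (hp1 : ∀ x, ∑ a, p a x = 1)
    (hq : ∀ a, IsC11 c₀ c₁ c₂ (q a)) :
    IsC11 c₀ (Fintype.card A * (C * c₀) + c₁) (Fintype.card A * (C * c₀ + 2 * C * c₁) + c₂)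
      fun x => ∑ a, p a x * q a x := by
  -- Terms that keep the undifferentiated weight p are averaged, at no cost; only terms with a
  -- difference or derivative of p pay the factor `Fintype.card A`. This is what prevents
  -- exponential growth when mixtures are iterated.
  have hconv : ∀ x (c : ℝ), ∑ a, p a x * c = c := fun x c => by
    rw [← Finset.sum_mul, hp1, one_mul]
  have hcard : ∀ c : ℝ, Fintype.card A * c = ∑ _a : A, c := fun c => by
    rw [Finset.sum_const, nsmul_eq_mul, Finset.card_univ]
  have hgrad : ∀ x, HasGradientAt (fun x => ∑ a, p a x * q a x)
      (∑ a, (p a x • ∇ (q a) x + q a x • ∇ (p a) x)) x := fun x =>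
    hasGradientAt_sum_mul _ (fun a _ => (hp a).differentiable x)
      fun a _ => (hq a).differentiable x
  refine ⟨fun x => (hgrad x).differentiableAt, fun x => ?_, fun x => ?_, fun x y => ?_⟩
  · rw [← hconv x c₀]
    refine (Finset.abs_sum_le_sum_abs _ _).trans (Finset.sum_le_sum fun a _ => ?_)
    rw [abs_mul, abs_of_nonneg (hp0 a x)]
    exact mul_le_mul_of_nonneg_left ((hq a).abs_le x) (hp0 a x)
  · rw [(hgrad x).gradient, hcard, ← hconv x c₁, ← Finset.sum_add_distrib]
    refine norm_sum_le_of_le _ fun a _ => ?_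
    rw [add_comm]
    refine norm_add_le_of_le ?_ ?_
    · rw [norm_smul, Real.norm_eq_abs, mul_comm]
      exact mul_le_mul ((hp a).norm_gradient_le x) ((hq a).abs_le x) (abs_nonneg _)
        (hp a).nonneg₁
    · rw [norm_smul, Real.norm_eq_abs, abs_of_nonneg (hp0 a x)]
      exact mul_le_mul_of_nonneg_left ((hq a).norm_gradient_le x) (hp0 a x)
  · rw [(hgrad x).gradient, (hgrad y).gradient, add_mul, mul_assoc, hcard,
      ← hconv x (c₂ * ‖x - y‖), ← Finset.sum_add_distrib, ← Finset.sum_sub_distrib]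
    refine norm_sum_le_of_le _ fun a _ => ?_
    have hC := (hp a).nonneg₁
    -- The splitting is arranged so that the difference of ∇q carries the weight p and contributes
    -- just c₂ after summation.
    have key : p a x • ∇ (q a) x + q a x • ∇ (p a) x - (p a y • ∇ (q a) y + q a y • ∇ (p a) y)
        = (q a x • (∇ (p a) x - ∇ (p a) y) + (p a x - p a y) • ∇ (q a) y
          + (q a x - q a y) • ∇ (p a) y) + p a x • (∇ (q a) x - ∇ (q a) y) := by
      module
    rw [key]
    refine norm_add_le_of_le ?_ ?_
    · calc _ ≤ c₀ * (C * ‖x - y‖) + (C * ‖x - y‖) * c₁ + (c₁ * ‖x - y‖) * C := by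
            refine norm_add_le_of_le (norm_add_le_of_le ?_ ?_) ?_
            · rw [norm_smul]
              exact mul_le_mul ((hq a).abs_le x) ((hp a).gradient_lipschitz x y) (norm_nonneg _)
                (hq a).nonneg₀
            · rw [norm_smul]
              exact mul_le_mul (abs_sub_le_of_norm_gradient_le (hp a).differentiable
                (hp a).norm_gradient_le x y) ((hq a).norm_gradient_le y) (norm_nonneg _)
                (by positivity)
            · rw [norm_smul]
              exact mul_le_mul (abs_sub_le_of_norm_gradient_le (hq a).differentiable
                (hq a).norm_gradient_le x y) ((hp a).norm_gradient_le y) (norm_nonneg _)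
                (mul_nonneg (hq a).nonneg₁ (norm_nonneg _))
        _ = _ := by ring
    · rw [norm_smul, Real.norm_eq_abs, abs_of_nonneg (hp0 a x)]
      exact mul_le_mul_of_nonneg_left ((hq a).gradient_lipschitz x y) (hp0 a x)

end IsC11

end Complete

/-! ### Differentiation under integrals and series. -/

section FiniteDimensional

variable [FiniteDimensional ℝ E] {Y : Type*} [MeasurableSpace Y]

/-- In an orthonormal basis the coordinates of the gradient are directional derivatives, hence
limits of measurable difference quotients with increment 1/n. -/
lemma stronglyMeasurable_gradient {f : E → Y → ℝ} {x : E} (hf : ∀ x, Measurable (f x))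
    (hd : ∀ y, DifferentiableAt ℝ (fun x => f x y) x) :
    StronglyMeasurable fun y => ∇ (fun x => f x y) x := by
  have h : (fun y => ∇ (fun x => f x y) x) = fun y => ∑ i,
      fderiv ℝ (fun x => f x y) x (stdOrthonormalBasis ℝ E i) • stdOrthonormalBasis ℝ E i := by
    funext y
    conv_lhs => rw [← (stdOrthonormalBasis ℝ E).sum_repr' (∇ (fun x => f x y) x)]
    refine Finset.sum_congr rfl fun i _ => ?_
    rw [real_inner_comm, inner_gradient_left]
  rw [h]
  refine Finset.stronglyMeasurable_fun_sum _ fun i _ => StronglyMeasurable.smul_const ?_ _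
  refine Measurable.stronglyMeasurable ?_
  refine measurable_of_tendsto_metrizable
    (f := fun (n : ℕ) y => (n : ℝ) • (f (x + (n : ℝ)⁻¹ • stdOrthonormalBasis ℝ E i) y - f x y))
    (fun n => ((hf _).sub (hf _)).const_smul (n : ℝ)) ?_
  rw [tendsto_pi_nhds]
  exact fun y => ((hd y).hasFDerivAt.lim_real _).comp tendsto_natCast_atTop_atTop

namespace IsC11

variable {ν : Measure Y} {f : E → Y → ℝ} {c₀ c₁ c₂ : Y → ℝ}

lemma integrable_gradient (hf : ∀ x, Measurable (f x))
    (h : ∀ y, IsC11 (c₀ y) (c₁ y) (c₂ y) fun x => f x y) (h₁ : Integrable c₁ ν) (x : E) :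
    Integrable (fun y => ∇ (fun x => f x y) x) ν :=
  h₁.mono' (stronglyMeasurable_gradient hf fun y => (h y).differentiable x).aestronglyMeasurable
    (ae_of_all _ fun y => (h y).norm_gradient_le x)

lemma hasGradientAt_integral (hf : ∀ x, Measurable (f x))
    (h : ∀ y, IsC11 (c₀ y) (c₁ y) (c₂ y) fun x => f x y) (h₀ : Integrable c₀ ν)
    (h₁ : Integrable c₁ ν) (x : E) :
    HasGradientAt (fun x => ∫ y, f x y ∂ν) (∫ y, ∇ (fun x => f x y) x ∂ν) x := by
  have hm := stronglyMeasurable_gradient (x := x) hf fun y => (h y).differentiable x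
  rw [hasGradientAt_iff_hasFDerivAt]
  have hcomm : (InnerProductSpace.toDual ℝ E) (∫ y, ∇ (fun x => f x y) x ∂ν) =
      ∫ y, fderiv ℝ (fun x => f x y) x ∂ν := by
    simp only [← toDual_gradient]
    exact ((InnerProductSpace.toDual ℝ E).toContinuousLinearEquiv.integral_comp_comm
      (fun y => ∇ (fun x => f x y) x)).symm
  rw [hcomm]
  refine hasFDerivAt_integral_of_dominated_of_fderiv_le (F := f)
    (F' := fun x y => fderiv ℝ (fun x => f x y) x) (bound := c₁) (s := Set.univ)
    Filter.univ_mem (.of_forall fun x => (hf x).aestronglyMeasurable)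
    (h₀.mono' (hf x).aestronglyMeasurable (ae_of_all _ fun y => (h y).abs_le x)) ?_
    (ae_of_all _ fun y z _ => by rw [← norm_gradient]; exact (h y).norm_gradient_le z) h₁
    (ae_of_all _ fun y z _ => ((h y).differentiable z).hasFDerivAt)
  simp only [← toDual_gradient]
  exact ((InnerProductSpace.toDual ℝ E).continuous.comp_stronglyMeasurable hm).aestronglyMeasurable

lemma integral (hf : ∀ x, Measurable (f x))
    (h : ∀ y, IsC11 (c₀ y) (c₁ y) (c₂ y) fun x => f x y) (h₀ : Integrable c₀ ν)
    (h₁ : Integrable c₁ ν) (h₂ : Integrable c₂ ν) :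
    IsC11 (∫ y, c₀ y ∂ν) (∫ y, c₁ y ∂ν) (∫ y, c₂ y ∂ν) fun x => ∫ y, f x y ∂ν where
  differentiable x := (hasGradientAt_integral hf h h₀ h₁ x).differentiableAt
  abs_le x := (Real.norm_eq_abs _).symm.trans_le <|
    norm_integral_le_of_norm_le h₀ (ae_of_all _ fun y => (h y).abs_le x)
  norm_gradient_le x := by
    rw [(hasGradientAt_integral hf h h₀ h₁ x).gradient]
    exact norm_integral_le_of_norm_le h₁ (ae_of_all _ fun y => (h y).norm_gradient_le x)
  gradient_lipschitz x y := by
    rw [(hasGradientAt_integral hf h h₀ h₁ x).gradient,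
      (hasGradientAt_integral hf h h₀ h₁ y).gradient,
      ← integral_sub (integrable_gradient hf h h₁ x) (integrable_gradient hf h h₁ y),
      ← integral_mul_const]
    exact norm_integral_le_of_norm_le (h₂.mul_const _)
      (ae_of_all _ fun z => (h z).gradient_lipschitz x y)

/-- The case of constants that do not depend on the point, for a probability measure. -/
lemma integral_prob {c₀ c₁ c₂ : ℝ} [IsProbabilityMeasure ν] (hf : ∀ x, Measurable (f x))
    (h : ∀ y, IsC11 c₀ c₁ c₂ fun x => f x y) : IsC11 c₀ c₁ c₂ fun x => ∫ y, f x y ∂ν := by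
  simpa using integral (ν := ν) hf h (integrable_const _) (integrable_const _) (integrable_const _)

lemma hasGradientAt_integral_prob {c₀ c₁ c₂ : ℝ} [IsProbabilityMeasure ν]
    (hf : ∀ x, Measurable (f x)) (h : ∀ y, IsC11 c₀ c₁ c₂ fun x => f x y) (x : E) :
    HasGradientAt (fun x => ∫ y, f x y ∂ν) (∫ y, ∇ (fun x => f x y) x ∂ν) x :=
  hasGradientAt_integral hf h (integrable_const _) (integrable_const _) x

end IsC11

lemma integral_count_nat {F : Type*} [NormedAddCommGroup F] [NormedSpace ℝ F]
    [CompleteSpace F] {f : ℕ → F}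
    (hf : Summable fun n => ‖f n‖) : ∫ n, f n ∂Measure.count = ∑' n, f n := by
  rw [integral_countable (integrable_count_iff.2 hf)]
  simp

namespace IsC11

variable {f : E → ℕ → ℝ} {c₀ c₁ c₂ : ℕ → ℝ}

/-- A series is an integral against counting measure on ℕ, so the result for integrals applies. -/
lemma tsum (h : ∀ n, IsC11 (c₀ n) (c₁ n) (c₂ n) fun x => f x n) (h₀ : Summable c₀)
    (h₁ : Summable c₁) (h₂ : Summable c₂) :
    IsC11 (∑' n, c₀ n) (∑' n, c₁ n) (∑' n, c₂ n) fun x => ∑' n, f x n := by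
  have := integral (ν := Measure.count) (f := f) (fun x => measurable_from_top) h
    (integrable_count_iff.2 h₀.norm) (integrable_count_iff.2 h₁.norm)
    (integrable_count_iff.2 h₂.norm)
  rw [integral_count_nat h₀.norm, integral_count_nat h₁.norm, integral_count_nat h₂.norm] at this
  convert this using 2 with x
  exact (integral_count_nat (h₀.of_nonneg_of_le (fun _ => norm_nonneg _)
    fun n => (h n).abs_le x)).symm

lemma gradient_tsum (h : ∀ n, IsC11 (c₀ n) (c₁ n) (c₂ n) fun x => f x n) (h₀ : Summable c₀)
    (h₁ : Summable c₁) (x : E) :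
    ∇ (fun x => ∑' n, f x n) x = ∑' n, ∇ (fun x => f x n) x := by
  have := (hasGradientAt_integral (ν := Measure.count) (f := f) (fun x => measurable_from_top) h
    (integrable_count_iff.2 h₀.norm) (integrable_count_iff.2 h₁.norm) x).gradient
  rw [integral_count_nat (h₁.of_nonneg_of_le (fun _ => norm_nonneg _)
    fun n => (h n).norm_gradient_le x)] at this
  rw [← this]
  congr 1 with x
  exact (integral_count_nat (h₀.of_nonneg_of_le (fun _ => norm_nonneg _)
    fun n => (h n).abs_le x)).symm

end IsC11

end FiniteDimensional

end Calculus

/-! ### Smoothness of the policy and of expected rewards, with explicit constants. -/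

namespace Model

variable {M X A : Type*} [MeasurableSpace M] [MeasurableSpace X] [MeasurableSpace A]
  {d z K : ℕ} (S : Model M X A d z K)

lemma contDiff_bitProb (m : M) (x : X) (k : Fin K) (b : Bool) {n : WithTop ℕ∞} :
    ContDiff ℝ n fun Ω : Param d z K => S.bitProb Ω m x k b := by
  have h : ContDiff ℝ n fun Ω : Param d z K => S.ψ x m ⬝ᵥ betaCol Ω k := by
    unfold dotProduct betaCol
    fun_prop
  have h2 : ContDiff ℝ n fun Ω : Param d z K =>
      1 / (1 + Real.exp (-S.αβ * (S.ψ x m ⬝ᵥ betaCol Ω k))) :=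
    contDiff_const.div (contDiff_const.add (contDiff_const.mul h).exp) fun Ω => by positivity
  unfold bitProb
  split_ifs
  · exact h2
  · exact contDiff_const.sub h2

lemma contDiff_skillProb (m : M) (x : X) (i : Skill K) {n : WithTop ℕ∞} :
    ContDiff ℝ n fun Ω : Param d z K => S.skillProb Ω m x i :=
  contDiff_prod fun k _ => S.contDiff_bitProb m x k (i k)

lemma bitProb_pos (Ω : Param d z K) (m : M) (x : X) (k : Fin K) (b : Bool) :
    0 < S.bitProb Ω m x k b := by
  have h := Real.exp_pos (-S.αβ * (S.ψ x m ⬝ᵥ betaCol Ω k))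
  unfold bitProb
  split_ifs
  · positivity
  · rw [sub_pos, div_lt_one (by positivity)]
    linarith

lemma skillProb_pos (Ω : Param d z K) (m : M) (x : X) (i : Skill K) :
    0 < S.skillProb Ω m x i :=
  Finset.prod_pos fun k _ => S.bitProb_pos Ω m x k (i k)

lemma measurable_skillProb (Ω : Param d z K) (i : Skill K) :
    Measurable fun p : M × X => S.skillProb Ω p.1 p.2 i := by
  refine Finset.measurable_fun_prod _ fun k _ => ?_
  have h : Measurable fun p : M × X => S.ψ p.2 p.1 :=
    S.measurable_ψ.comp (measurable_snd.prodMk measurable_fst)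
  have h1 : Measurable fun p : M × X => S.ψ p.2 p.1 ⬝ᵥ betaCol Ω k := by
    unfold dotProduct
    exact Finset.measurable_fun_sum _ fun j _ =>
      ((measurable_pi_apply j).comp h).mul_const _
  unfold bitProb
  split_ifs <;> fun_prop

variable [Fintype A]

lemma contDiff_intraSkill [Nonempty A] (x : X) (i : Skill K) (a : A) {n : WithTop ℕ∞} :
    ContDiff ℝ n fun Ω : Param d z K => S.intraSkill Ω x i a := by
  have h : ∀ b, ContDiff ℝ n fun Ω : Param d z K =>
      Real.exp (S.αθ * (S.φ x b ⬝ᵥ thetaCol Ω i)) := by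
    intro b
    unfold dotProduct thetaCol
    fun_prop
  exact (h a).div (ContDiff.sum fun _ _ => h _) fun Ω =>
    (Finset.sum_pos (fun _ _ => Real.exp_pos _) Finset.univ_nonempty).ne'

lemma intraSkill_pos [Nonempty A] (Ω : Param d z K) (x : X) (i : Skill K) (a : A) :
    0 < S.intraSkill Ω x i a :=
  div_pos (Real.exp_pos _) (Finset.sum_pos (fun _ _ => Real.exp_pos _) Finset.univ_nonempty)

lemma contDiff_policy [Nonempty A] (m : M) (x : X) (a : A) {n : WithTop ℕ∞} :
    ContDiff ℝ n fun Ω : Param d z K => S.policy Ω m x a :=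
  ContDiff.sum fun i _ => (S.contDiff_skillProb m x i).mul (S.contDiff_intraSkill x i a)

lemma policy_nonneg (Ω : Param d z K) (m : M) (x : X) (a : A) : 0 ≤ S.policy Ω m x a :=
  Finset.sum_nonneg fun i _ => mul_nonneg (S.skillProb_nonneg Ω m x i) (S.intraSkill_nonneg Ω x i a)

lemma policy_pos [Nonempty A] (Ω : Param d z K) (m : M) (x : X) (a : A) :
    0 < S.policy Ω m x a :=
  Finset.sum_pos (fun i _ => mul_pos (S.skillProb_pos Ω m x i) (S.intraSkill_pos Ω x i a))
    Finset.univ_nonempty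

lemma sum_policy [Nonempty A] (Ω : Param d z K) (m : M) (x : X) : ∑ a, S.policy Ω m x a = 1 := by
  unfold policy
  rw [Finset.sum_comm]
  simp [← Finset.mul_sum, sum_intraSkill, sum_skillProb]

lemma policy_le_one [Nonempty A] (Ω : Param d z K) (m : M) (x : X) (a : A) :
    S.policy Ω m x a ≤ 1 := by
  rw [← S.sum_policy Ω m x]
  exact Finset.single_le_sum (fun b _ => S.policy_nonneg Ω m x b) (Finset.mem_univ a)

lemma measurable_policy (Ω : Param d z K) (a : A) :
    Measurable fun p : M × X => S.policy Ω p.1 p.2 a :=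
  Finset.measurable_fun_sum _ fun i _ => (S.measurable_skillProb Ω i).mul
    ((S.measurable_intraSkill Ω i a).comp measurable_snd)

lemma isC11_policy [Nonempty A] {B : ℝ} (hB0 : 0 ≤ B) {m : M} {x : X} {a : A}
    (hB : ∀ Ω : Param d z K, ‖iteratedFDeriv ℝ 2 (fun Ω' => S.policy Ω' m x a) Ω‖ ≤ B) :
    IsC11 1 (1 + B) (1 + B) fun Ω => S.policy Ω m x a where
  differentiable := (S.contDiff_policy m x a (n := 1)).differentiable (by norm_num)
  abs_le Ω := by
    rw [abs_of_nonneg (S.policy_nonneg Ω m x a)]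
    exact S.policy_le_one Ω m x a
  norm_gradient_le := norm_gradient_le_of_lipschitz hB0
    ((S.contDiff_policy m x a (n := 1)).differentiable (by norm_num))
    (fun Ω => S.policy_nonneg Ω m x a) (fun Ω => S.policy_le_one Ω m x a)
    (norm_gradient_sub_le_of_iteratedFDeriv_two (S.contDiff_policy m x a) hB)
  gradient_lipschitz Ω Ω' :=
    (norm_gradient_sub_le_of_iteratedFDeriv_two (S.contDiff_policy m x a) hB Ω Ω').trans
      (by gcongr; linarith)

/-- The reward expected `t` steps after playing `a` in the state `x`, under `π_Ω` afterwards. -/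
def futureReward (Ω : Param d z K) (m : M) : ℕ → X → A → ℝ
  | 0, x, a => S.reward m x a
  | t + 1, x, a => ∫ y, ∑ b, S.policy Ω m y b * futureReward Ω m t y b ∂S.trans (m, x, a)

/-- The reward expected after `t` steps under `π_Ω` from the state `x`. -/
def rewardAt (Ω : Param d z K) (m : M) (t : ℕ) (x : X) : ℝ :=
  ∑ a, S.policy Ω m x a * S.futureReward Ω m t x a

lemma futureReward_succ (Ω : Param d z K) (m : M) (t : ℕ) (x : X) (a : A) :
    S.futureReward Ω m (t + 1) x a = ∫ y, S.rewardAt Ω m t y ∂S.trans (m, x, a) := rfl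

@[simp]
lemma futureReward_zero (Ω : Param d z K) (m : M) (x : X) (a : A) :
    S.futureReward Ω m 0 x a = S.reward m x a := rfl

attribute [irreducible] futureReward

lemma measurable_futureReward (Ω : Param d z K) (t : ℕ) :
    Measurable fun p : M × X × A => S.futureReward Ω p.1 t p.2.1 p.2.2 := by
  induction t with
  | zero => simpa only [futureReward_zero] using S.measurable_reward
  | succ t ih =>
    have h : Measurable fun p : M × X => S.rewardAt Ω p.1 t p.2 := by
      refine Finset.measurable_fun_sum _ fun b _ => (S.measurable_policy Ω b).mul ?_
      have hm : Measurable fun p : M × X => (p.1, p.2, b) :=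
        measurable_fst.prodMk (measurable_snd.prodMk measurable_const)
      exact ih.comp hm
    have hm : Measurable fun p : (M × X × A) × X => (p.1.1, p.2) :=
      (measurable_fst.comp measurable_fst).prodMk measurable_snd
    simp only [futureReward_succ]
    exact ((h.comp hm).stronglyMeasurable.integral_kernel_prod_right' (κ := S.trans)).measurable

lemma measurable_futureReward_action (Ω : Param d z K) (t : ℕ) (a : A) :
    Measurable fun p : M × X => S.futureReward Ω p.1 t p.2 a := by
  have hm : Measurable fun p : M × X => (p.1, p.2, a) :=
    measurable_fst.prodMk (measurable_snd.prodMk measurable_const)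
  exact (S.measurable_futureReward Ω t).comp hm

lemma measurable_rewardAt (Ω : Param d z K) (t : ℕ) :
    Measurable fun p : M × X => S.rewardAt Ω p.1 t p.2 := by
  unfold rewardAt
  exact Finset.measurable_fun_sum _ fun b _ => (S.measurable_policy Ω b).mul
    (S.measurable_futureReward_action Ω t b)

lemma measurable_rewardAt_right (Ω : Param d z K) (m : M) (t : ℕ) :
    Measurable fun x : X => S.rewardAt Ω m t x := by
  have hm : Measurable fun x : X => (m, x) := measurable_prodMk_left
  have h := (S.measurable_rewardAt Ω t).comp hm
  simp only [Function.comp_def] at h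
  exact h

variable [Nonempty A]

/-- The hypotheses on rewards and policy, with explicit constants. -/
structure Bounds (b B : ℝ) : Prop where
  reward_le : ∀ m x a, |S.reward m x a| ≤ b
  isC11_policy : ∀ m x a, IsC11 1 B B fun Ω => S.policy Ω m x a

/-- A constant for the growth of the derivatives of the expected rewards. -/
def growthConst (A : Type*) [Fintype A] (b B : ℝ) : ℝ :=
  b + Fintype.card A * B * b * (2 + 2 * (Fintype.card A * B))

variable {S} {b B : ℝ}

/-- Put D = |A|B. By the mixture estimate, one more step adds Db to the gradient bound, which is
therefore linear in t. It adds Db + 2D·(Dbt) to the Lipschitz constant, which is at most the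
increment of Db(1 + 2D)t². -/
lemma Bounds.isC11_futureReward (h : S.Bounds b B) (m : M) (t : ℕ) (x : X) (a : A) :
    IsC11 b (Fintype.card A * B * b * t)
      (Fintype.card A * B * b * (1 + 2 * (Fintype.card A * B)) * t ^ 2)
      fun Ω => S.futureReward Ω m t x a := by
  induction t generalizing x a with
  | zero =>
    have := IsC11.const (E := Param d z K) (h.reward_le m x a)
    simpa using this
  | succ t ih =>
    have hB : 0 ≤ B := (h.isC11_policy m x a).nonneg₁
    have hb : 0 ≤ b := (ih x a).nonneg₀
    simp only [futureReward_succ]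
    refine (IsC11.integral_prob (fun Ω => S.measurable_rewardAt_right Ω m t) fun y =>
      IsC11.mixture (h.isC11_policy m y) (fun a Ω => S.policy_nonneg Ω m y a)
        (fun Ω => S.sum_policy Ω m y) (ih y)).mono le_rfl ?_ ?_
    · apply le_of_eq
      push_cast
      ring
    · have ht : (0 : ℝ) ≤ t := t.cast_nonneg
      have hD : (0 : ℝ) ≤ Fintype.card A * B := by positivity
      generalize hDD : (Fintype.card A : ℝ) * B = D at hD
      rw [show (Fintype.card A : ℝ) * (B * b + 2 * B * (D * b * t)) =
        D * b + 2 * D * (D * b * t) by rw [← hDD]; ring]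
      push_cast
      have := mul_nonneg (mul_nonneg hD hb) hD
      have := mul_nonneg (mul_nonneg hD hb) ht
      have := mul_nonneg (mul_nonneg (mul_nonneg hD hb) hD) ht
      nlinarith

/-- One quadratic majorant serves all three bounds, since only summability against the horizon
weights matters later. -/
lemma Bounds.isC11_rewardAt (h : S.Bounds b B) (m : M) (t : ℕ) (x : X) :
    IsC11 (growthConst A b B * (t + 1) ^ 2) (growthConst A b B * (t + 1) ^ 2)
      (growthConst A b B * (t + 1) ^ 2) fun Ω => S.rewardAt Ω m t x := by
  obtain ⟨a⟩ := ‹Nonempty A›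
  have hB : 0 ≤ B := (h.isC11_policy m x a).nonneg₁
  have hb : 0 ≤ b := (h.isC11_futureReward m t x a).nonneg₀
  have ht : (0 : ℝ) ≤ t := t.cast_nonneg
  have hD : (0 : ℝ) ≤ Fintype.card A * B := by positivity
  unfold rewardAt
  refine (IsC11.mixture (h.isC11_policy m x) (fun a Ω => S.policy_nonneg Ω m x a)
    (fun Ω => S.sum_policy Ω m x) (h.isC11_futureReward m t x)).mono ?_ ?_ ?_
  all_goals
    unfold growthConst
    generalize hDD : (Fintype.card A : ℝ) * B = D at hD
    have h1 := mul_nonneg hD hb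
    have h2 := mul_nonneg h1 hD
    have h3 := mul_nonneg h1 ht
    have h4 := mul_nonneg h2 ht
    have h5 := mul_nonneg hb ht
  · nlinarith [mul_nonneg h5 ht, mul_nonneg h3 ht, mul_nonneg h4 ht]
  · rw [← mul_assoc, hDD]
    nlinarith [mul_nonneg h5 ht, mul_nonneg h3 ht, mul_nonneg h4 ht]
  · rw [show (Fintype.card A : ℝ) * (B * b + 2 * B * (D * b * t)) = D * b + 2 * D * (D * b * t) by
      rw [← hDD]; ring]
    nlinarith [mul_nonneg h5 ht, mul_nonneg h3 ht, mul_nonneg h4 ht]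

end Model

/-! ### Marginals and Markov property of the trajectory law. -/

lemma trajMeasure_map_zero {X : ℕ → Type*} [∀ n, MeasurableSpace (X n)] (μ₀ : Measure (X 0))
    [IsProbabilityMeasure μ₀] (κ : (n : ℕ) → Kernel ((i : Finset.Iic n) → X i) (X (n + 1)))
    [∀ n, IsMarkovKernel (κ n)] : (Kernel.trajMeasure μ₀ κ).map (fun g => g 0) = μ₀ := by
  -- The index set `Finset.Iic 0` has one point, so a history up to time 0 is just an initial value,
  -- on which no transition has acted.
  obtain ⟨e, he, he', h0⟩ : ∃ e : X 0 → (i : Finset.Iic 0) → X i, Measurable e ∧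
      (∀ x, e x ⟨0, Finset.mem_Iic.2 le_rfl⟩ = x) ∧
      (Kernel.trajMeasure μ₀ κ).map (Preorder.frestrictLe 0) = μ₀.map e := by
    refine ⟨(MeasurableEquiv.piUnique (fun i : Finset.Iic 0 => X i)).symm,
      MeasurableEquiv.measurable _, fun x => rfl, ?_⟩
    rw [Kernel.trajMeasure, Measure.map_comp _ _ (by fun_prop), Kernel.traj_map_frestrictLe,
      Kernel.partialTraj_self, Measure.id_comp]
    rfl
  have h1 : Measurable fun h : (i : Finset.Iic 0) → X i => h ⟨0, Finset.mem_Iic.2 le_rfl⟩ :=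
    measurable_pi_apply _
  have h2 := congrArg (Measure.map fun h : (i : Finset.Iic 0) → X i =>
    h ⟨0, Finset.mem_Iic.2 le_rfl⟩) h0
  rw [Measure.map_map h1 (by fun_prop), Measure.map_map h1 he] at h2
  refine h2.trans ?_
  simp only [Function.comp_def, he', Measure.map_id']

namespace Model

variable {M X A : Type*} [MeasurableSpace M] [MeasurableSpace X] [MeasurableSpace A]
  {d z K : ℕ} (S : Model M X A d z K) [Fintype A]

section Choice

variable [DiscreteMeasurableSpace A] {F : Type*} [NormedAddCommGroup F] [NormedSpace ℝ F]

lemma integral_choiceKernel [CompleteSpace F] (Ω : Param d z K) (m : M) (x : X)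
    (f : Skill K × A → F) :
    ∫ ia, f ia ∂S.choiceKernel Ω m x =
      ∑ ia : Skill K × A, (S.skillProb Ω m x ia.1 * S.intraSkill Ω x ia.1 ia.2) • f ia := by
  simp only [choiceKernel, Kernel.coe_mk]
  rw [integral_finsetSum_measure fun ia _ => (integrable_dirac (by simp)).smul_measure (by simp)]
  refine Finset.sum_congr rfl fun ia _ => ?_
  rw [integral_smul_measure, integral_dirac, ENNReal.toReal_ofReal
    (mul_nonneg (S.skillProb_nonneg Ω m x _) (S.intraSkill_nonneg Ω x _ _))]

omit [DiscreteMeasurableSpace A] in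
lemma sum_choice_action (Ω : Param d z K) (m : M) (x : X) (f : A → F) :
    ∑ ia : Skill K × A, (S.skillProb Ω m x ia.1 * S.intraSkill Ω x ia.1 ia.2) • f ia.2 =
      ∑ a, S.policy Ω m x a • f a := by
  rw [Fintype.sum_prod_type_right]
  simp only [policy, Finset.sum_smul]

end Choice

variable [Nonempty A]

/-- The law of the next state, given the current step. -/
def nextState (m : M) : Kernel (Step X A K) X :=
  S.trans.comap (fun s : Step X A K => (m, s.1, s.2.2)) (by fun_prop)

omit [Fintype A] [Nonempty A] in
lemma nextState_apply (m : M) (s : Step X A K) : S.nextState m s = S.trans (m, s.1, s.2.2) :=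
  Kernel.comap_apply _ _ _

instance (m : M) : IsMarkovKernel (S.nextState m) := by
  unfold nextState
  infer_instance

lemma stepKernel_apply (Ω : Param d z K) (m : M) (s : Step X A K) :
    S.stepKernel Ω m s = S.trans (m, s.1, s.2.2) ⊗ₘ S.choiceKernel Ω m := by
  rw [← nextState_apply, Measure.compProd_eq_comp_prod, ← Kernel.comp_apply,
    ← Kernel.compProd_prodMkLeft_eq_comp]
  rfl

section Traj

variable (Ω : Param d z K) (m : M) (ν : Measure X) [IsProbabilityMeasure ν]

instance : IsProbabilityMeasure (S.trajLawFrom Ω m ν) := by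
  unfold trajLawFrom
  infer_instance

lemma map_history_trajLawFrom (n : ℕ) :
    (S.trajLawFrom Ω m ν).map (fun g => (Preorder.frestrictLe n g, g (n + 1))) =
      (S.trajLawFrom Ω m ν).map (Preorder.frestrictLe n) ⊗ₘ (S.stepKernel Ω m).comap
        (fun h : (i : Finset.Iic n) → Step X A K => h ⟨n, Finset.mem_Iic.2 le_rfl⟩)
        (measurable_pi_apply _) :=
  Kernel.map_frestrictLe_trajMeasure_compProd_eq_map_trajMeasure.symm

/-- The law of the `n`-th state. -/
def stateLaw (n : ℕ) : Measure X := (S.trajLawFrom Ω m ν).map fun g => (g n).1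

instance (n : ℕ) : IsProbabilityMeasure (S.stateLaw Ω m ν n) :=
  Measure.isProbabilityMeasure_map
    (measurable_fst.comp (measurable_pi_apply n)).aemeasurable

lemma map_zero_trajLawFrom :
    (S.trajLawFrom Ω m ν).map (fun g => g 0) = ν ⊗ₘ S.choiceKernel Ω m :=
  trajMeasure_map_zero _ _

lemma map_succ_trajLawFrom (n : ℕ) :
    (S.trajLawFrom Ω m ν).map (fun g => g (n + 1)) =
      S.stepKernel Ω m ∘ₘ (S.trajLawFrom Ω m ν).map (fun g => g n) := by
  have h := congrArg Measure.snd (S.map_history_trajLawFrom Ω m ν n)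
  rw [Measure.snd_compProd, Measure.snd_map_prodMk (by fun_prop),
    ← Kernel.comp_deterministic_eq_comap, ← Measure.comp_assoc,
    Measure.deterministic_comp_eq_map, Measure.map_map (by fun_prop) (by fun_prop)] at h
  exact h

omit [IsProbabilityMeasure ν] in
lemma fst_map_eval (n : ℕ) :
    ((S.trajLawFrom Ω m ν).map fun g => g n).fst = S.stateLaw Ω m ν n :=
  Measure.map_map measurable_fst (measurable_pi_apply n)

lemma stateLaw_zero : S.stateLaw Ω m ν 0 = ν := by
  rw [← fst_map_eval, map_zero_trajLawFrom, Measure.fst_compProd]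

/-- The law of a step, as the law of the state followed by the choice of skill and action. -/
lemma map_eval_trajLawFrom (n : ℕ) :
    (S.trajLawFrom Ω m ν).map (fun g => g n) = S.stateLaw Ω m ν n ⊗ₘ S.choiceKernel Ω m := by
  cases n with
  | zero => rw [stateLaw_zero, map_zero_trajLawFrom]
  | succ n =>
    have h : S.stepKernel Ω m ∘ₘ (S.trajLawFrom Ω m ν).map (fun g => g n) =
        (S.nextState m ∘ₘ (S.trajLawFrom Ω m ν).map (fun g => g n)) ⊗ₘ S.choiceKernel Ω m := by
      rw [Measure.compProd_eq_comp_prod, Measure.comp_assoc, ← Kernel.compProd_prodMkLeft_eq_comp]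
      rfl
    rw [← fst_map_eval, map_succ_trajLawFrom, h, Measure.fst_compProd]

variable {F : Type*} [NormedAddCommGroup F] [NormedSpace ℝ F]

/-- The Markov property, tested on a function of an earlier step and the next one. The freedom s ≤ n
serves both a score followed by a later reward and a reward followed by a later score. -/
lemma integral_next {f : Step X A K → Step X A K → F}
    (hf : StronglyMeasurable (Function.uncurry f)) {s n : ℕ} (hs : s ≤ n)
    (hint : Integrable (fun g => f (g s) (g (n + 1))) (S.trajLawFrom Ω m ν)) :
    ∫ g, f (g s) (g (n + 1)) ∂S.trajLawFrom Ω m ν =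
      ∫ g, ∫ y, f (g s) y ∂S.stepKernel Ω m (g n) ∂S.trajLawFrom Ω m ν := by
  have hm : Measurable fun p : ((i : Finset.Iic n) → Step X A K) × Step X A K =>
      (p.1 ⟨s, Finset.mem_Iic.2 hs⟩, p.2) := by fun_prop
  have hF := hf.comp_measurable hm
  have hT : Measurable fun g : ℕ → Step X A K =>
      ((Preorder.frestrictLe n g : (i : Finset.Iic n) → Step X A K), g (n + 1)) := by fun_prop
  have hint' := (integrable_map_measure hF.aestronglyMeasurable hT.aemeasurable).2 hint
  have h1 := integral_map (μ := S.trajLawFrom Ω m ν) hT.aemeasurable hF.aestronglyMeasurable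
  rw [map_history_trajLawFrom] at h1 hint'
  refine h1.symm.trans ?_
  rw [Measure.integral_compProd hint', integral_map (by fun_prop) ?_]
  · rfl
  · exact (hF.integral_kernel_prod_right').aestronglyMeasurable

variable [DiscreteMeasurableSpace A]

lemma integral_eval [CompleteSpace F] {f : Step X A K → F} (hf : StronglyMeasurable f) (n : ℕ)
    (hint : Integrable (fun g => f (g n)) (S.trajLawFrom Ω m ν)) :
    ∫ g, f (g n) ∂S.trajLawFrom Ω m ν =
      ∫ x, ∑ ia : Skill K × A, (S.skillProb Ω m x ia.1 * S.intraSkill Ω x ia.1 ia.2) • f (x, ia)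
        ∂S.stateLaw Ω m ν n := by
  have hn : Measurable fun g : ℕ → Step X A K => g n := measurable_pi_apply n
  have hint' := (integrable_map_measure hf.aestronglyMeasurable hn.aemeasurable).2 hint
  rw [← integral_map hn.aemeasurable hf.aestronglyMeasurable]
  rw [map_eval_trajLawFrom] at hint' ⊢
  rw [Measure.integral_compProd hint']
  simp only [integral_choiceKernel]

lemma integral_stepKernel [CompleteSpace F] {f : Step X A K → F} {u : Step X A K}
    (hint : Integrable f (S.stepKernel Ω m u)) :
    ∫ v, f v ∂S.stepKernel Ω m u =
      ∫ y, ∑ ia : Skill K × A, (S.skillProb Ω m y ia.1 * S.intraSkill Ω y ia.1 ia.2) • f (y, ia)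
        ∂S.trans (m, u.1, u.2.2) := by
  rw [stepKernel_apply] at hint ⊢
  rw [Measure.integral_compProd hint]
  simp only [integral_choiceKernel]

end Traj
end Model

/-! ### Conditional expectations along a trajectory and the policy gradient of a single reward. -/

namespace Model

variable {M X A : Type*} [MeasurableSpace M] [MeasurableSpace X] [MeasurableSpace A]
  {d z K : ℕ} {S : Model M X A d z K} [Fintype A] [Nonempty A]
  {b B : ℝ}

variable (S) in
omit [Nonempty A] in
lemma measurable_futureReward_step (Ω : Param d z K) (m : M) (t : ℕ) :
    Measurable fun v : Step X A K => S.futureReward Ω m t v.1 v.2.2 := by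
  have hm : Measurable fun v : Step X A K => (m, v.1, v.2.2) := by fun_prop
  have h := (S.measurable_futureReward Ω t).comp hm
  simp only [Function.comp_def] at h
  exact h

lemma Bounds.abs_futureReward_le (h : S.Bounds b B) (Ω : Param d z K) (m : M) (t : ℕ) (x : X)
    (a : A) : |S.futureReward Ω m t x a| ≤ b :=
  (h.isC11_futureReward m t x a).abs_le Ω

lemma Bounds.differentiable_rewardAt (h : S.Bounds b B) (m : M) (t : ℕ) (x : X) :
    Differentiable ℝ fun Ω => S.rewardAt Ω m t x :=
  (h.isC11_rewardAt m t x).differentiable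

lemma Bounds.integral_stepKernel_futureReward [DiscreteMeasurableSpace A] (h : S.Bounds b B)
    (Ω : Param d z K) (m : M) (t : ℕ) (u : Step X A K) :
    ∫ v, S.futureReward Ω m t v.1 v.2.2 ∂S.stepKernel Ω m u =
      S.futureReward Ω m (t + 1) u.1 u.2.2 := by
  rw [integral_stepKernel, futureReward_succ]
  · refine integral_congr_ae (ae_of_all _ fun y => ?_)
    exact sum_choice_action S Ω m y fun a => S.futureReward Ω m t y a
  · exact Integrable.of_bound (S.measurable_futureReward_step Ω m t).aestronglyMeasurable b
      (ae_of_all _ fun v => h.abs_futureReward_le Ω m t v.1 v.2.2)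

section Traj

variable [DiscreteMeasurableSpace A] (Ω : Param d z K) (m : M) (ν : Measure X)
  [IsProbabilityMeasure ν] {F : Type*} [NormedAddCommGroup F] [NormedSpace ℝ F] [CompleteSpace F]

/-- Rewards earned after time `s` may be replaced by their expectation given the step `s`. -/
lemma Bounds.integral_futureReward_smul (h : S.Bounds b B) {f : Step X A K → F}
    (hf : StronglyMeasurable f) (s : ℕ)
    (hint : Integrable (fun g => f (g s)) (S.trajLawFrom Ω m ν)) (k j : ℕ) :
    ∫ g, S.futureReward Ω m j (g (s + k)).1 (g (s + k)).2.2 • f (g s) ∂S.trajLawFrom Ω m ν =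
      ∫ g, S.futureReward Ω m (j + k) (g s).1 (g s).2.2 • f (g s) ∂S.trajLawFrom Ω m ν := by
  induction k generalizing j with
  | zero => rfl
  | succ k ih =>
    have hm := S.measurable_futureReward_step Ω m j
    have hm' : Measurable fun g : ℕ → Step X A K =>
        S.futureReward Ω m j (g (s + k + 1)).1 (g (s + k + 1)).2.2 :=
      hm.comp (measurable_pi_apply (s + k + 1))
    have h1 := S.integral_next Ω m ν
      (f := fun u v => S.futureReward Ω m j v.1 v.2.2 • f u)
      ((hm.stronglyMeasurable.comp_measurable measurable_snd).smul
        (hf.comp_measurable measurable_fst)) (Nat.le_add_right s k)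
      (hint.bdd_smul b hm'.aestronglyMeasurable
        (ae_of_all _ fun g => h.abs_futureReward_le Ω m j _ _))
    -- Averaging out the latest step moves the evaluation point one step back and increases the
    -- delay j by one.
    rw [← add_assoc, h1, show j + (k + 1) = j + 1 + k by ring, ← ih]
    refine integral_congr_ae (ae_of_all _ fun g => ?_)
    dsimp only
    rw [integral_smul_const, h.integral_stepKernel_futureReward]

lemma Bounds.integral_reward (h : S.Bounds b B) (t : ℕ) :
    ∫ g, S.reward m (g t).1 (g t).2.2 ∂S.trajLawFrom Ω m ν = ∫ x, S.rewardAt Ω m t x ∂ν := by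
  have h1 := h.integral_futureReward_smul Ω m ν (f := fun _ => (1 : ℝ))
    stronglyMeasurable_const 0 (integrable_const _) t 0
  simp only [futureReward_zero, zero_add, smul_eq_mul, mul_one] at h1
  have hm := S.measurable_futureReward_step Ω m t
  rw [h1, S.integral_eval Ω m ν (f := fun v => S.futureReward Ω m t v.1 v.2.2)
    hm.stronglyMeasurable, stateLaw_zero]
  · refine integral_congr_ae (ae_of_all _ fun y => ?_)
    exact sum_choice_action S Ω m y fun a => S.futureReward Ω m t y a
  · exact Integrable.of_bound (hm.comp (measurable_pi_apply 0)).aestronglyMeasurable b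
      (ae_of_all _ fun g => h.abs_futureReward_le Ω m t _ _)

variable (S) in
/-- Expectation of a function of the state at time `s + 1`, given the step at time `s`. -/
lemma integral_stateLaw_succ {H : X → F} (hH : StronglyMeasurable H) {C : ℝ}
    (hC : ∀ x, ‖H x‖ ≤ C) (s : ℕ) :
    ∫ x, H x ∂S.stateLaw Ω m ν (s + 1) =
      ∫ x, ∑ a, S.policy Ω m x a • ∫ y, H y ∂S.trans (m, x, a) ∂S.stateLaw Ω m ν s := by
  have hT : Measurable fun g : ℕ → Step X A K => (g (s + 1)).1 :=
    measurable_fst.comp (measurable_pi_apply _)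
  have hm : Measurable fun v : Step X A K => (m, v.1, v.2.2) := by fun_prop
  have hmY : StronglyMeasurable fun u : Step X A K => ∫ y, H y ∂S.trans (m, u.1, u.2.2) :=
    ((hH.comp_measurable measurable_snd).integral_kernel_prod_right' (κ := S.trans)).comp_measurable
      hm
  have hbd : ∀ u : Step X A K, ‖∫ y, H y ∂S.trans (m, u.1, u.2.2)‖ ≤ C := fun u => by
    simpa using norm_integral_le_of_norm_le_const (μ := S.trans (m, u.1, u.2.2))
      (ae_of_all _ hC)
  have h1 := S.integral_next Ω m ν (f := fun _ v => H v.1)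
    (hH.comp_measurable (measurable_fst.comp measurable_snd)) (le_refl s)
    (Integrable.of_bound (hH.comp_measurable hT).aestronglyMeasurable C
      (ae_of_all _ fun g => hC _))
  rw [stateLaw, integral_map hT.aemeasurable hH.aestronglyMeasurable, h1]
  have h2 : ∀ u, ∫ v, H v.1 ∂S.stepKernel Ω m u = ∫ y, H y ∂S.trans (m, u.1, u.2.2) := fun u => by
    rw [integral_stepKernel]
    · refine integral_congr_ae (ae_of_all _ fun y => ?_)
      dsimp only
      rw [sum_choice_action S Ω m y fun _ => H y, ← Finset.sum_smul, sum_policy, one_smul]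
    · exact Integrable.of_bound (hH.comp_measurable measurable_fst).aestronglyMeasurable C
        (ae_of_all _ fun v => hC _)
  simp only [h2]
  rw [S.integral_eval Ω m ν (f := fun u => ∫ y, H y ∂S.trans (m, u.1, u.2.2)) hmY]
  · refine integral_congr_ae (ae_of_all _ fun x => ?_)
    exact sum_choice_action S Ω m x fun a => ∫ y, H y ∂S.trans (m, x, a)
  · exact Integrable.of_bound (hmY.comp_measurable (measurable_pi_apply s)).aestronglyMeasurable C
      (ae_of_all _ fun g => hbd _)

end Traj

section Gradient

lemma measurable_section {M X : Type*} [MeasurableSpace M] [MeasurableSpace X] {f : M → X → ℝ}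
    (hf : Measurable fun p : M × X => f p.1 p.2) (m : M) : Measurable (f m) :=
  hf.comp measurable_prodMk_left

variable (S) in
/-- The contribution `∑_a q_k(x, a) ∂π(a | x)/∂Ω` of one decision to the derivative of the reward
earned `k` steps later. -/
def gradTerm (Ω : Param d z K) (m : M) (k : ℕ) (x : X) : Param d z K :=
  ∑ a, S.futureReward Ω m k x a • ∇ (fun Ω' => S.policy Ω' m x a) Ω

variable (S) in
lemma stronglyMeasurable_gradient_policy (Ω : Param d z K) (m : M) (a : A) :
    StronglyMeasurable fun x => ∇ (fun Ω' => S.policy Ω' m x a) Ω :=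
  stronglyMeasurable_gradient (f := fun Ω' x => S.policy Ω' m x a)
    (fun Ω' => measurable_section (f := fun m x => S.policy Ω' m x a) (S.measurable_policy Ω' a) m)
    fun x => (S.contDiff_policy m x a (n := 1)).differentiable (by norm_num) Ω

lemma stronglyMeasurable_gradTerm (Ω : Param d z K) (m : M) (k : ℕ) :
    StronglyMeasurable (S.gradTerm Ω m k) := by
  refine Finset.stronglyMeasurable_fun_sum _ fun a _ => ?_
  exact (measurable_section (f := fun m x => S.futureReward Ω m k x a)
    (S.measurable_futureReward_action Ω k a) m).stronglyMeasurable.smul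
    (S.stronglyMeasurable_gradient_policy Ω m a)

lemma Bounds.norm_gradTerm_le (h : S.Bounds b B) (Ω : Param d z K) (m : M) (k : ℕ) (x : X) :
    ‖S.gradTerm Ω m k x‖ ≤ Fintype.card A * (b * B) := by
  rw [← nsmul_eq_mul, ← Finset.card_univ, ← Finset.sum_const]
  refine norm_sum_le_of_le _ fun a _ => ?_
  rw [norm_smul]
  have h1 := h.abs_futureReward_le Ω m k x a
  exact mul_le_mul h1 ((h.isC11_policy m x a).norm_gradient_le Ω) (norm_nonneg _)
    ((abs_nonneg _).trans h1)

lemma Bounds.stronglyMeasurable_gradient_rewardAt (h : S.Bounds b B) (Ω : Param d z K) (m : M)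
    (k : ℕ) : StronglyMeasurable fun x => ∇ (fun Ω' => S.rewardAt Ω' m k x) Ω :=
  stronglyMeasurable_gradient (f := fun Ω' x => S.rewardAt Ω' m k x)
    (fun Ω' => S.measurable_rewardAt_right Ω' m k) fun x => h.differentiable_rewardAt m k x Ω

lemma Bounds.gradient_futureReward_succ (h : S.Bounds b B) (Ω : Param d z K) (m : M)
    (k : ℕ) (x : X) (a : A) :
    ∇ (fun Ω' => S.futureReward Ω' m (k + 1) x a) Ω =
      ∫ y, ∇ (fun Ω' => S.rewardAt Ω' m k y) Ω ∂S.trans (m, x, a) := by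
  simp only [futureReward_succ]
  exact (IsC11.hasGradientAt_integral_prob (fun Ω => S.measurable_rewardAt_right Ω m k)
    (h.isC11_rewardAt m k) Ω).gradient

/-- The product rule separates the effect of the present decision from that of all later ones. -/
lemma Bounds.gradient_rewardAt (h : S.Bounds b B) (Ω : Param d z K) (m : M) (k : ℕ) (x : X) :
    ∇ (fun Ω' => S.rewardAt Ω' m k x) Ω = S.gradTerm Ω m k x +
      ∑ a, S.policy Ω m x a • ∇ (fun Ω' => S.futureReward Ω' m k x a) Ω := by
  unfold rewardAt gradTerm
  rw [(hasGradientAt_sum_mul Finset.univ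
    (fun a _ => (h.isC11_policy m x a).differentiable Ω)
    (fun a _ => (h.isC11_futureReward m k x a).differentiable Ω)).gradient,
    ← Finset.sum_add_distrib]
  exact Finset.sum_congr rfl fun a _ => add_comm _ _

/-- The policy gradient theorem for the reward of a single time step. -/
lemma Bounds.integral_gradient_rewardAt [DiscreteMeasurableSpace A] (h : S.Bounds b B)
    (Ω : Param d z K) (m : M)
    (ν : Measure X) [IsProbabilityMeasure ν] (k s : ℕ) :
    ∫ x, ∇ (fun Ω' => S.rewardAt Ω' m k x) Ω ∂S.stateLaw Ω m ν s =
      ∑ j ∈ Finset.range (k + 1), ∫ x, S.gradTerm Ω m (k - j) x ∂S.stateLaw Ω m ν (s + j) := by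
  induction k generalizing s with
  | zero =>
    simp [h.gradient_rewardAt]
  | succ k ih =>
    rw [Finset.sum_range_succ']
    have hG : Integrable (S.gradTerm Ω m (k + 1)) (S.stateLaw Ω m ν s) :=
      Integrable.of_bound (stronglyMeasurable_gradTerm Ω m _).aestronglyMeasurable _
        (ae_of_all _ fun x => h.norm_gradTerm_le Ω m _ x)
    have hR : Integrable (fun x => ∇ (fun Ω' => S.rewardAt Ω' m (k + 1) x) Ω)
        (S.stateLaw Ω m ν s) :=
      Integrable.of_bound (h.stronglyMeasurable_gradient_rewardAt Ω m _).aestronglyMeasurable _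
        (ae_of_all _ fun x => (h.isC11_rewardAt m (k + 1) x).norm_gradient_le Ω)
    -- Solved for the effect of later decisions, the product rule turns the one-step law of the
    -- state into a recursion: each use splits off one `gradTerm` and moves time from s to s + 1.
    have hdiff : ∀ x, ∑ a, S.policy Ω m x a • ∇ (fun Ω' => S.futureReward Ω' m (k + 1) x a) Ω =
        ∇ (fun Ω' => S.rewardAt Ω' m (k + 1) x) Ω - S.gradTerm Ω m (k + 1) x := fun x => by
      rw [h.gradient_rewardAt, add_sub_cancel_left]
    have hstep := S.integral_stateLaw_succ Ω m ν (h.stronglyMeasurable_gradient_rewardAt Ω m k)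
      (fun x => (h.isC11_rewardAt m k x).norm_gradient_le Ω) s
    simp only [← h.gradient_futureReward_succ, hdiff] at hstep
    rw [integral_sub hR hG, ih, eq_sub_iff_add_eq] at hstep
    rw [← hstep]
    simp [add_assoc, add_comm 1]

end Gradient

end Model

/-! ### Horizon weights, the expected return and the objective. -/

namespace Model

variable {M X A : Type*} [MeasurableSpace M] [MeasurableSpace X] [MeasurableSpace A]
  {d z K : ℕ} (S : Model M X A d z K)

open Classical in
/-- The weight of the reward at time `t` in task `m`. -/
def weight (m : M) (t : ℕ) : ℝ := if (t : ℕ∞) ≤ S.horizon m then S.γ ^ t else 0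

lemma weight_nonneg (m : M) (t : ℕ) : 0 ≤ S.weight m t := by
  unfold weight
  split_ifs
  · exact pow_nonneg S.γ_nonneg t
  · exact le_rfl

lemma measurable_weight (t : ℕ) : Measurable fun m => S.weight m t := by
  refine Measurable.ite ?_ measurable_const measurable_const
  exact S.measurable_horizon (MeasurableSet.of_discrete (s := Set.Ici (t : ℕ∞)))

lemma ret_eq_tsum (m : M) (g : ℕ → Step X A K) :
    S.ret m g = ∑' t, S.weight m t * S.reward m (g t).1 (g t).2.2 := by
  unfold ret weight
  refine tsum_congr fun t => ?_
  split_ifs <;> simp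

/-- A common majorant for the weights of all tasks, with a finite second moment. -/
structure WeightBound (W : ℕ → ℝ) : Prop where
  weight_le : ∀ m t, S.weight m t ≤ W t
  nonneg : ∀ t, 0 ≤ W t
  summable : Summable fun t => W t * ((t : ℝ) + 1) ^ 2

/-- Geometric weights absorb any polynomial when γ < 1; with uniformly bounded horizons the
indicator of t ≤ N suffices, because γ ≤ 1. -/
lemma exists_weightBound (hH : S.γ < 1 ∨ ∃ N : ℕ, ∀ m, S.horizon m ≤ (N : ℕ∞)) :
    ∃ W, S.WeightBound W := by
  rcases hH with hγ | ⟨N, hN⟩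
  · refine ⟨fun t => S.γ ^ t, fun m t => ?_, fun t => pow_nonneg S.γ_nonneg t, ?_⟩
    · unfold weight
      split_ifs
      · exact le_rfl
      · exact pow_nonneg S.γ_nonneg t
    · have hn : ‖S.γ‖ < 1 := by rwa [Real.norm_eq_abs, abs_of_nonneg S.γ_nonneg]
      have h2 := summable_pow_mul_geometric_of_norm_lt_one 2 hn
      have h1 := summable_pow_mul_geometric_of_norm_lt_one 1 hn
      have h0 := summable_geometric_of_norm_lt_one hn
      refine ((h2.add (h1.mul_left 2)).add h0).congr fun t => ?_
      ring
  · refine ⟨fun t => if t ≤ N then 1 else 0, fun m t => ?_, fun t => by positivity, ?_⟩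
    · unfold weight
      by_cases ht : (t : ℕ∞) ≤ S.horizon m
      · rw [if_pos ht, if_pos (by exact_mod_cast ht.trans (hN m))]
        exact pow_le_one₀ S.γ_nonneg S.γ_le_one
      · rw [if_neg ht]
        positivity
    · refine summable_of_ne_finset_zero (s := Finset.range (N + 1)) fun t ht => ?_
      rw [if_neg (by simpa [Nat.lt_succ_iff] using ht), zero_mul]

namespace WeightBound

variable {S} {W : ℕ → ℝ}

lemma summable_bound (hW : S.WeightBound W) : Summable W :=
  hW.summable.of_nonneg_of_le hW.nonneg fun t =>
    le_mul_of_one_le_right (hW.nonneg t) (one_le_pow₀ (by linarith [t.cast_nonneg (α := ℝ)]))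

lemma summable_weight (hW : S.WeightBound W) (m : M) : Summable (S.weight m) :=
  hW.summable_bound.of_nonneg_of_le (S.weight_nonneg m) (hW.weight_le m)

end WeightBound

variable {S} [Fintype A] [Nonempty A] {b B : ℝ} {W : ℕ → ℝ}

section Traj

variable (Ω : Param d z K) (m : M) (ν : Measure X)
  [IsProbabilityMeasure ν]

lemma Bounds.integrable_weighted_reward (h : S.Bounds b B) (t : ℕ) :
    Integrable (fun g => S.weight m t * S.reward m (g t).1 (g t).2.2) (S.trajLawFrom Ω m ν) := by
  refine Integrable.const_mul ?_ _
  have hm := S.measurable_futureReward_step Ω m 0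
  simp only [futureReward_zero] at hm
  exact Integrable.of_bound (hm.comp (measurable_pi_apply t)).aestronglyMeasurable b
    (ae_of_all _ fun g => h.reward_le m _ _)

lemma Bounds.integral_ret [DiscreteMeasurableSpace A] (h : S.Bounds b B) (hW : S.WeightBound W) :
    ∫ g, S.ret m g ∂S.trajLawFrom Ω m ν = ∑' t, S.weight m t * ∫ x, S.rewardAt Ω m t x ∂ν := by
  simp only [ret_eq_tsum]
  rw [← integral_tsum_of_summable_integral_norm fun t =>
    h.integrable_weighted_reward Ω m ν t]
  · refine tsum_congr fun t => ?_
    rw [integral_const_mul, h.integral_reward Ω m ν]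
  · refine ((hW.summable_weight m).mul_right b).of_nonneg_of_le
      (fun t => integral_nonneg fun g => norm_nonneg _) fun t => ?_
    have : ‖∫ g, ‖S.weight m t * S.reward m (g t).1 (g t).2.2‖ ∂S.trajLawFrom Ω m ν‖ ≤ _ :=
      norm_integral_le_of_norm_le_const (μ := S.trajLawFrom Ω m ν)
      (f := fun g => ‖S.weight m t * S.reward m (g t).1 (g t).2.2‖) (C := S.weight m t * b)
      (ae_of_all _ fun g => by
        rw [norm_norm, norm_mul, Real.norm_eq_abs, abs_of_nonneg (S.weight_nonneg m t)]
        exact mul_le_mul_of_nonneg_left (h.reward_le m _ _) (S.weight_nonneg m t))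
    rw [probReal_univ, mul_one] at this
    exact (le_abs_self _).trans this

lemma Bounds.expReturn_eq [DiscreteMeasurableSpace A] (h : S.Bounds b B) (hW : S.WeightBound W) :
    S.expReturn Ω m = ∑' t, S.weight m t * ∫ x, S.rewardAt Ω m t x ∂S.init m :=
  h.integral_ret Ω m (S.init m) hW

end Traj

section Objective

/-- A common constant for the expected return and its first two derivatives. -/
def returnConst (A : Type*) [Fintype A] (b B : ℝ) (W : ℕ → ℝ) : ℝ :=
  ∑' t : ℕ, W t * (growthConst A b B * ((t : ℝ) + 1) ^ 2)

omit [Nonempty A] in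
lemma summable_returnConst (hW : S.WeightBound W) :
    Summable fun t : ℕ => W t * (growthConst A b B * ((t : ℝ) + 1) ^ 2) :=
  (hW.summable.mul_left (growthConst A b B)).congr fun t => by ring

lemma Bounds.isC11_weighted (h : S.Bounds b B) (hW : S.WeightBound W) (m : M) (ν : Measure X)
    [IsProbabilityMeasure ν] (t : ℕ) :
    IsC11 (W t * (growthConst A b B * ((t : ℝ) + 1) ^ 2))
      (W t * (growthConst A b B * ((t : ℝ) + 1) ^ 2))
      (W t * (growthConst A b B * ((t : ℝ) + 1) ^ 2))
      fun Ω => S.weight m t * ∫ x, S.rewardAt Ω m t x ∂ν := by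
  have h1 := IsC11.integral_prob (ν := ν) (fun Ω => S.measurable_rewardAt_right Ω m t)
    (h.isC11_rewardAt m t)
  have h2 : |S.weight m t| * (growthConst A b B * ((t : ℝ) + 1) ^ 2) ≤
      W t * (growthConst A b B * ((t : ℝ) + 1) ^ 2) := by
    rw [abs_of_nonneg (S.weight_nonneg m t)]
    exact mul_le_mul_of_nonneg_right (hW.weight_le m t) h1.nonneg₀
  exact (h1.const_mul (S.weight m t)).mono h2 h2 h2

variable [DiscreteMeasurableSpace A]

lemma Bounds.isC11_expReturn (h : S.Bounds b B) (hW : S.WeightBound W) (m : M) :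
    IsC11 (returnConst A b B W) (returnConst A b B W) (returnConst A b B W)
      fun Ω => S.expReturn Ω m := by
  simp only [h.expReturn_eq _ _ hW]
  exact IsC11.tsum (h.isC11_weighted hW m (S.init m)) (summable_returnConst hW)
    (summable_returnConst hW) (summable_returnConst hW)

/-- The common form to which both alternative update directions are reduced: a sum over reward times
t and decision times j ≤ t. -/
lemma Bounds.gradient_expReturn (h : S.Bounds b B) (hW : S.WeightBound W) (Ω : Param d z K)
    (m : M) :
    ∇ (fun Ω => S.expReturn Ω m) Ω =
      ∑' t, S.weight m t • ∑ j ∈ Finset.range (t + 1),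
        ∫ x, S.gradTerm Ω m (t - j) x ∂S.stateLaw Ω m (S.init m) j := by
  simp only [h.expReturn_eq _ _ hW]
  rw [IsC11.gradient_tsum (h.isC11_weighted hW m (S.init m)) (summable_returnConst hW)
    (summable_returnConst hW)]
  refine tsum_congr fun t => ?_
  have h1 := IsC11.hasGradientAt_integral_prob (ν := S.init m)
    (fun Ω => S.measurable_rewardAt_right Ω m t) (h.isC11_rewardAt m t) Ω
  rw [gradient_const_mul h1.differentiableAt, h1.gradient]
  have h2 := h.integral_gradient_rewardAt Ω m (S.init m) t 0
  rw [stateLaw_zero] at h2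
  simp only [h2, zero_add]

lemma Bounds.measurable_expReturn (h : S.Bounds b B) (hW : S.WeightBound W) (Ω : Param d z K) :
    Measurable fun m => S.expReturn Ω m := by
  have hterm : ∀ t, Measurable fun m => S.weight m t * ∫ x, S.rewardAt Ω m t x ∂S.init m :=
    fun t => (S.measurable_weight t).mul
      ((S.measurable_rewardAt Ω t).stronglyMeasurable.integral_kernel_prod_right'
        (κ := S.init)).measurable
  refine measurable_of_tendsto_metrizable (f := fun (n : ℕ) m => ∑ t ∈ Finset.range n,
      S.weight m t * ∫ x, S.rewardAt Ω m t x ∂S.init m)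
    (fun n => Finset.measurable_fun_sum _ fun t _ => hterm t) ?_
  rw [tendsto_pi_nhds]
  intro m
  rw [h.expReturn_eq Ω m hW]
  refine Summable.tendsto_sum_tsum_nat ?_
  exact (summable_returnConst hW).of_norm_bounded fun t =>
    (h.isC11_weighted hW m (S.init m) t).abs_le Ω

variable (μ : Measure M) [IsProbabilityMeasure μ]

lemma Bounds.isC11_objective (h : S.Bounds b B) (hW : S.WeightBound W) :
    IsC11 (returnConst A b B W) (returnConst A b B W) (returnConst A b B W) (S.objective μ) :=
  IsC11.integral_prob (f := fun Ω m => S.expReturn Ω m) (h.measurable_expReturn hW)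
    (h.isC11_expReturn hW)

lemma Bounds.gradient_objective (h : S.Bounds b B) (hW : S.WeightBound W) (Ω : Param d z K) :
    ∇ (S.objective μ) Ω = ∫ m, ∇ (fun Ω => S.expReturn Ω m) Ω ∂μ :=
  (IsC11.hasGradientAt_integral_prob (f := fun Ω m => S.expReturn Ω m)
    (h.measurable_expReturn hW) (h.isC11_expReturn hW) Ω).gradient

lemma Bounds.integrable_gradient_expReturn (h : S.Bounds b B) (hW : S.WeightBound W)
    (Ω : Param d z K) : Integrable (fun m => ∇ (fun Ω => S.expReturn Ω m) Ω) μ :=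
  IsC11.integrable_gradient (f := fun Ω m => S.expReturn Ω m) (h.measurable_expReturn hW)
    (h.isC11_expReturn hW) (integrable_const _) Ω

end Objective

end Model

/-! ### The score function and the likelihood-ratio gradient. -/

lemma integrable_bdd_smul {α F : Type*} [MeasurableSpace α] {μ : Measure α} [NormedAddCommGroup F]
    [NormedSpace ℝ F] {φ : α → ℝ} {f : α → F} {C : ℝ} (hφ : Measurable φ) (hC : ∀ x, |φ x| ≤ C)
    (hf : Integrable f μ) : Integrable (fun x => φ x • f x) μ :=
  hf.bdd_smul C hφ.aestronglyMeasurable (ae_of_all _ hC)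

namespace Model

variable {M X A : Type*} [MeasurableSpace M] [MeasurableSpace X] [MeasurableSpace A]
  {d z K : ℕ} {S : Model M X A d z K} [Fintype A] [Nonempty A]
  {b B : ℝ} {W : ℕ → ℝ}

section Score

variable (S)

lemma differentiable_choiceProb (m : M) (x : X) (ia : Skill K × A) :
    Differentiable ℝ fun Ω : Param d z K => S.skillProb Ω m x ia.1 * S.intraSkill Ω x ia.1 ia.2 :=
  ((S.contDiff_skillProb m x ia.1 (n := 1)).differentiable (by norm_num)).mul
    ((S.contDiff_intraSkill x ia.1 ia.2 (n := 1)).differentiable (by norm_num))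

lemma choiceProb_pos (Ω : Param d z K) (m : M) (x : X) (ia : Skill K × A) :
    0 < S.skillProb Ω m x ia.1 * S.intraSkill Ω x ia.1 ia.2 :=
  mul_pos (S.skillProb_pos Ω m x ia.1) (S.intraSkill_pos Ω x ia.1 ia.2)

lemma differentiable_logLik (m : M) (s : Step X A K) :
    Differentiable ℝ fun Ω : Param d z K => S.logLik Ω m s :=
  (S.differentiable_choiceProb m s.1 s.2).log fun Ω => (S.choiceProb_pos Ω m s.1 s.2).ne'

lemma choiceProb_smul_gradient_logLik (Ω : Param d z K) (m : M) (x : X) (ia : Skill K × A) :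
    (S.skillProb Ω m x ia.1 * S.intraSkill Ω x ia.1 ia.2) •
        ∇ (fun Ω' => S.logLik Ω' m (x, ia)) Ω =
      ∇ (fun Ω' => S.skillProb Ω' m x ia.1 * S.intraSkill Ω' x ia.1 ia.2) Ω := by
  apply (InnerProductSpace.toDual ℝ (Param d z K)).injective
  rw [map_smul, toDual_gradient, toDual_gradient]
  have h := ((S.differentiable_choiceProb m x ia Ω).hasFDerivAt.log
    (S.choiceProb_pos Ω m x ia).ne').fderiv
  unfold logLik
  dsimp only
  rw [h, smul_smul, mul_inv_cancel₀ (S.choiceProb_pos Ω m x ia).ne', one_smul]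

/-- The score identity: averaging `c(a) ∇Z` over skills and actions gives `∑_a c(a) ∇π(a)`. -/
lemma sum_choiceProb_smul_gradient_logLik (Ω : Param d z K) (m : M) (x : X) (c : A → ℝ) :
    ∑ ia : Skill K × A, (S.skillProb Ω m x ia.1 * S.intraSkill Ω x ia.1 ia.2) •
        (c ia.2 • ∇ (fun Ω' => S.logLik Ω' m (x, ia)) Ω) =
      ∑ a, c a • ∇ (fun Ω' => S.policy Ω' m x a) Ω := by
  rw [Fintype.sum_prod_type_right]
  refine Finset.sum_congr rfl fun a _ => ?_
  simp only [smul_comm _ (c a), ← Finset.smul_sum]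
  congr 1
  have h1 : ∀ i, (S.skillProb Ω m x i * S.intraSkill Ω x i a) •
      ∇ (fun Ω' => S.logLik Ω' m (x, i, a)) Ω =
        ∇ (fun Ω' => S.skillProb Ω' m x i * S.intraSkill Ω' x i a) Ω :=
    fun i => S.choiceProb_smul_gradient_logLik Ω m x (i, a)
  apply (InnerProductSpace.toDual ℝ (Param d z K)).injective
  simp only [h1, map_sum, toDual_gradient]
  exact (fderiv_fun_sum fun i _ => S.differentiable_choiceProb m x (i, a) Ω).symm

/-- The probabilities sum to the constant 1. This is why the score has mean zero. -/
lemma sum_gradient_policy (Ω : Param d z K) (m : M) (x : X) :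
    ∑ a, ∇ (fun Ω' => S.policy Ω' m x a) Ω = 0 := by
  apply (InnerProductSpace.toDual ℝ (Param d z K)).injective
  simp only [map_sum, toDual_gradient, map_zero]
  rw [← fderiv_fun_sum fun a _ =>
    (S.contDiff_policy m x a (n := 1)).differentiable (by norm_num) Ω]
  simp [sum_policy]

variable [DiscreteMeasurableSpace A]

lemma stronglyMeasurable_gradient_logLik (Ω : Param d z K) (m : M) :
    StronglyMeasurable fun s : Step X A K => ∇ (fun Ω' => S.logLik Ω' m s) Ω := by
  refine stronglyMeasurable_gradient (f := fun Ω' (s : Step X A K) => S.logLik Ω' m s)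
    (fun Ω' => ?_) fun s => S.differentiable_logLik m s Ω
  refine measurable_from_prod_countable_left fun ia => ?_
  exact ((measurable_section (f := fun m x => S.skillProb Ω' m x ia.1)
    (S.measurable_skillProb Ω' ia.1) m).mul (S.measurable_intraSkill Ω' ia.1 ia.2)).log

lemma integral_stepKernel_gradient_logLik (Ω : Param d z K) (m : M) (u : Step X A K) :
    ∫ v, ∇ (fun Ω' => S.logLik Ω' m v) Ω ∂S.stepKernel Ω m u = 0 := by
  by_cases hint : Integrable (fun v => ∇ (fun Ω' => S.logLik Ω' m v) Ω) (S.stepKernel Ω m u)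
  · rw [integral_stepKernel S Ω m hint]
    refine integral_eq_zero_of_ae (ae_of_all _ fun y => ?_)
    have h := S.sum_choiceProb_smul_gradient_logLik Ω m y fun _ => 1
    simp only [one_smul, sum_gradient_policy] at h
    exact h
  -- Without integrability the Bochner integral is 0 by convention, so the identity needs no
  -- hypothesis.
  · exact integral_undef hint

end Score

section LikelihoodRatio

variable [DiscreteMeasurableSpace A] (Ω : Param d z K) (m : M) (ν : Measure X)
  [IsProbabilityMeasure ν]

omit [DiscreteMeasurableSpace A] [IsProbabilityMeasure ν] in
lemma Bounds.integrable_reward_smul_score (h : S.Bounds b B) {s : ℕ}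
    (hint : Integrable (fun g => ∇ (fun Ω' => S.logLik Ω' m (g s)) Ω) (S.trajLawFrom Ω m ν))
    (t : ℕ) :
    Integrable (fun g => S.reward m (g t).1 (g t).2.2 • ∇ (fun Ω' => S.logLik Ω' m (g s)) Ω)
      (S.trajLawFrom Ω m ν) := by
  have hm := S.measurable_futureReward_step Ω m 0
  simp only [futureReward_zero] at hm
  have hm' : Measurable fun g : ℕ → Step X A K => S.reward m (g t).1 (g t).2.2 :=
    hm.comp (measurable_pi_apply t)
  have hb : ∀ g : ℕ → Step X A K, ‖S.reward m (g t).1 (g t).2.2‖ ≤ b :=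
    fun g => h.reward_le m _ _
  exact integrable_bdd_smul hm' hb hint

/-- Replace the reward by its expectation given step s; averaging over the skill and action at time
s then turns the score into the derivative of the policy. -/
lemma Bounds.integral_reward_smul_score_of_le (h : S.Bounds b B) {s t : ℕ} (hst : s ≤ t)
    (hint : Integrable (fun g => ∇ (fun Ω' => S.logLik Ω' m (g s)) Ω) (S.trajLawFrom Ω m ν)) :
    ∫ g, S.reward m (g t).1 (g t).2.2 • ∇ (fun Ω' => S.logLik Ω' m (g s)) Ω
        ∂S.trajLawFrom Ω m ν =
      ∫ x, S.gradTerm Ω m (t - s) x ∂S.stateLaw Ω m ν s := by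
  have h1 := h.integral_futureReward_smul Ω m ν (S.stronglyMeasurable_gradient_logLik Ω m) s hint
    (t - s) 0
  simp only [futureReward_zero, zero_add, Nat.add_sub_cancel' hst] at h1
  have hm := S.measurable_futureReward_step Ω m (t - s)
  have hm' : Measurable fun g : ℕ → Step X A K =>
      S.futureReward Ω m (t - s) (g s).1 (g s).2.2 := hm.comp (measurable_pi_apply s)
  have hb : ∀ g : ℕ → Step X A K, ‖S.futureReward Ω m (t - s) (g s).1 (g s).2.2‖ ≤ b :=
    fun g => h.abs_futureReward_le Ω m _ _ _
  rw [h1, S.integral_eval Ω m ν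
    (f := fun v => S.futureReward Ω m (t - s) v.1 v.2.2 • ∇ (fun Ω' => S.logLik Ω' m v) Ω)
    (hm.stronglyMeasurable.smul (S.stronglyMeasurable_gradient_logLik Ω m))
    s (integrable_bdd_smul hm' hb hint)]
  refine integral_congr_ae (ae_of_all _ fun x => ?_)
  exact S.sum_choiceProb_smul_gradient_logLik Ω m x fun a => S.futureReward Ω m (t - s) x a

/-- Causality: a reward earned before decision s is fixed when that decision is drawn, and the score
has conditional mean zero. -/
lemma Bounds.integral_reward_smul_score_of_lt (h : S.Bounds b B) {s t : ℕ} (hst : t < s)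
    (hint : Integrable (fun g => ∇ (fun Ω' => S.logLik Ω' m (g s)) Ω) (S.trajLawFrom Ω m ν)) :
    ∫ g, S.reward m (g t).1 (g t).2.2 • ∇ (fun Ω' => S.logLik Ω' m (g s)) Ω
        ∂S.trajLawFrom Ω m ν = 0 := by
  obtain ⟨n, rfl⟩ : ∃ n, s = n + 1 := ⟨s - 1, by omega⟩
  have hm := S.measurable_futureReward_step Ω m 0
  simp only [futureReward_zero] at hm
  have h1 := S.integral_next Ω m ν
    (f := fun u v => S.reward m u.1 u.2.2 • ∇ (fun Ω' => S.logLik Ω' m v) Ω)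
    ((hm.stronglyMeasurable.comp_measurable measurable_fst).smul
      ((S.stronglyMeasurable_gradient_logLik Ω m).comp_measurable measurable_snd))
    (Nat.lt_succ_iff.1 hst) (h.integrable_reward_smul_score Ω m ν hint t)
  rw [h1]
  simp only [integral_smul, integral_stepKernel_gradient_logLik, smul_zero, integral_zero]

omit [Fintype A] [Nonempty A] [DiscreteMeasurableSpace A] in
lemma weight_eq_zero {m : M} (hm : S.horizon m ≠ ⊤) {t : ℕ}
    (ht : t ∉ Finset.range ((S.horizon m).toNat + 1)) : S.weight m t = 0 := by
  unfold weight
  rw [if_neg]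
  intro hle
  rw [Finset.mem_range, Nat.lt_succ_iff] at ht
  exact ht (ENat.toNat_le_toNat hle hm)

/-- The likelihood-ratio form of the gradient of the expected return of one task. -/
lemma Bounds.integral_ret_smul_score (h : S.Bounds b B) (hW : S.WeightBound W)
    (hm : S.horizon m ≠ ⊤)
    (hint : ∀ t : ℕ, (t : ℕ∞) ≤ S.horizon m →
      Integrable (fun g => ∇ (fun Ω' => S.logLik Ω' m (g t)) Ω) (S.trajLaw Ω m)) :
    ∫ g, S.ret m g • ∑ t ∈ Finset.range ((S.horizon m).toNat + 1),
      ∇ (fun Ω' => S.logLik Ω' m (g t)) Ω ∂S.trajLaw Ω m =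
    ∇ (fun Ω' => S.expReturn Ω' m) Ω := by
  have hle : ∀ s ∈ Finset.range ((S.horizon m).toNat + 1), (s : ℕ∞) ≤ S.horizon m := by
    intro s hs
    rw [← ENat.natCast_toNat hm]
    exact_mod_cast Nat.lt_succ_iff.1 (Finset.mem_range.1 hs)
  have hret : ∀ g : ℕ → Step X A K, S.ret m g • ∑ s ∈ Finset.range ((S.horizon m).toNat + 1),
      ∇ (fun Ω' => S.logLik Ω' m (g s)) Ω = ∑ t ∈ Finset.range ((S.horizon m).toNat + 1),
      ∑ s ∈ Finset.range ((S.horizon m).toNat + 1), S.weight m t •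
        (S.reward m (g t).1 (g t).2.2 • ∇ (fun Ω' => S.logLik Ω' m (g s)) Ω) := fun g => by
    rw [ret_eq_tsum, tsum_eq_sum (s := Finset.range ((S.horizon m).toNat + 1))
      fun t ht => by rw [weight_eq_zero hm ht, zero_mul], Finset.sum_smul_sum]
    simp only [smul_smul]
  simp only [hret]
  have hterm : ∀ t, ∀ s ∈ Finset.range ((S.horizon m).toNat + 1),
      Integrable (fun g => S.weight m t •
        (S.reward m (g t).1 (g t).2.2 • ∇ (fun Ω' => S.logLik Ω' m (g s)) Ω))
        (S.trajLaw Ω m) := fun t s hs =>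
    integrable_bdd_smul measurable_const (fun _ => le_rfl)
      (h.integrable_reward_smul_score Ω m (S.init m) (hint s (hle s hs)) t)
  rw [integral_finsetSum _ fun t _ => integrable_finsetSum _ fun s hs => hterm t s hs,
    h.gradient_expReturn hW,
    tsum_eq_sum (s := Finset.range ((S.horizon m).toNat + 1))
      fun t ht => by rw [weight_eq_zero hm ht, zero_smul]]
  refine Finset.sum_congr rfl fun t ht => ?_
  rw [integral_finsetSum _ (hterm t), Finset.smul_sum]
  -- Of the full square of pairs (t, s), those with s > t vanish by causality.
  have hsub : Finset.range (t + 1) ⊆ Finset.range ((S.horizon m).toNat + 1) :=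
    Finset.range_subset_range.2 (Finset.mem_range.1 ht)
  rw [← Finset.sum_subset hsub]
  · refine Finset.sum_congr rfl fun s hs => ?_
    rw [integral_smul]
    congr 1
    exact h.integral_reward_smul_score_of_le Ω m (S.init m)
      (Nat.lt_succ_iff.1 (Finset.mem_range.1 hs)) (hint s (hle s (hsub hs)))
  · intro s hs hs'
    rw [integral_smul]
    have := h.integral_reward_smul_score_of_lt Ω m (S.init m) (s := s) (t := t)
      (by simpa [Nat.lt_succ_iff] using hs') (hint s (hle s hs))
    rw [← trajLaw] at this
    rw [this, smul_zero]

lemma Bounds.asapGradient_eq (h : S.Bounds b B) (hW : S.WeightBound W) (μ : Measure M)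
    [IsProbabilityMeasure μ] (hG : S.HasASAPGradient μ Ω) :
    S.asapGradient μ Ω = ∇ (S.objective μ) Ω := by
  rw [h.gradient_objective μ hW]
  refine integral_congr_ae ?_
  filter_upwards [hG] with m hm
  exact h.integral_ret_smul_score Ω m hW hm.1 hm.2

end LikelihoodRatio

end Model

/-! ### Infinite horizon and compatible function approximation. -/

lemma tsum_geometric_antidiagonal {F : Type*} [NormedAddCommGroup F] [NormedSpace ℝ F]
    [CompleteSpace F] {γ C : ℝ} (hγ0 : 0 ≤ γ) (hγ1 : γ < 1) {I : ℕ → ℕ → F}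
    (hI : ∀ k j, ‖I k j‖ ≤ C) :
    ∑' j, γ ^ j • ∑' k, γ ^ k • I k j =
      ∑' t, γ ^ t • ∑ j ∈ Finset.range (t + 1), I (t - j) j := by
  have hg := summable_geometric_of_lt_one hγ0 hγ1
  have hs : Summable fun p : ℕ × ℕ => γ ^ (p.1 + p.2) • I p.2 p.1 := by
    refine ((hg.mul_of_nonneg hg (fun _ => pow_nonneg hγ0 _) fun _ => pow_nonneg hγ0 _).mul_right
      C).of_norm_bounded fun p => ?_
    rw [norm_smul, Real.norm_eq_abs, abs_of_nonneg (pow_nonneg hγ0 _), pow_add]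
    exact mul_le_mul_of_nonneg_left (hI _ _) (by positivity)
  have h1 : ∑' j, γ ^ j • ∑' k, γ ^ k • I k j = ∑' p : ℕ × ℕ, γ ^ (p.1 + p.2) • I p.2 p.1 := by
    rw [hs.tsum_prod]
    refine tsum_congr fun j => ?_
    rw [← tsum_const_smul'']
    simp only [smul_smul, pow_add]
  -- Absolute summability permits regrouping decision time j and delay k by the reward time t = j +
  -- k.
  rw [h1, ← Finset.HasAntidiagonal.sigmaAntidiagonalEquivProd.tsum_eq
    fun p : ℕ × ℕ => γ ^ (p.1 + p.2) • I p.2 p.1]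
  have hs' := Finset.HasAntidiagonal.sigmaAntidiagonalEquivProd.summable_iff.2 hs
  refine (Summable.tsum_sigma hs').trans (tsum_congr fun t => ?_)
  rw [tsum_fintype, ← Finset.Nat.sum_antidiagonal_eq_sum_range_succ (fun j k => I k j) t,
    Finset.smul_sum]
  refine (Finset.sum_coe_sort (Finset.HasAntidiagonal.antidiagonal t)
    fun p : ℕ × ℕ => γ ^ (p.1 + p.2) • I p.2 p.1).trans ?_
  exact Finset.sum_congr rfl fun p hp => by rw [Finset.HasAntidiagonal.mem_antidiagonal.1 hp]

namespace Model

variable {M X A : Type*} [MeasurableSpace M] [MeasurableSpace X] [MeasurableSpace A]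
  {d z K : ℕ} {S : Model M X A d z K} [Fintype A] [Nonempty A]
  {b B : ℝ} {W : ℕ → ℝ}

section InfiniteHorizon

omit [Fintype A] [Nonempty A] in
lemma weight_of_horizon_eq_top {m : M} (hm : S.horizon m = ⊤) (t : ℕ) :
    S.weight m t = S.γ ^ t := by
  simp [weight, hm]

variable [DiscreteMeasurableSpace A] (Ω : Param d z K) {m : M}

lemma Bounds.value_eq (h : S.Bounds b B) (hW : S.WeightBound W) (hm : S.horizon m = ⊤) (x : X) :
    S.value Ω m x = ∑' t, S.γ ^ t * S.rewardAt Ω m t x := by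
  unfold value
  rw [h.integral_ret Ω m _ hW]
  refine tsum_congr fun t => ?_
  rw [integral_dirac' _ _ (S.measurable_rewardAt_right Ω m t).stronglyMeasurable,
    weight_of_horizon_eq_top hm]

lemma Bounds.integral_value (h : S.Bounds b B) (hW : S.WeightBound W) (hm : S.horizon m = ⊤)
    (ν : Measure X) [IsProbabilityMeasure ν] :
    ∫ y, S.value Ω m y ∂ν = ∑' t, S.γ ^ t * ∫ y, S.rewardAt Ω m t y ∂ν := by
  have hbd : ∀ t x, ‖S.γ ^ t * S.rewardAt Ω m t x‖ ≤
      W t * (growthConst A b B * ((t : ℝ) + 1) ^ 2) := fun t x => by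
    have h1 := (h.isC11_rewardAt m t x).abs_le Ω
    rw [norm_mul, Real.norm_eq_abs, Real.norm_eq_abs, abs_of_nonneg (pow_nonneg S.γ_nonneg t),
      ← weight_of_horizon_eq_top hm]
    exact mul_le_mul (hW.weight_le m t) h1 (abs_nonneg _) (hW.nonneg t)
  have hmeas : ∀ t, Measurable fun x => S.γ ^ t * S.rewardAt Ω m t x := fun t =>
    (S.measurable_rewardAt_right Ω m t).const_mul _
  have hint : ∀ t, Integrable (fun x => S.γ ^ t * S.rewardAt Ω m t x) ν := fun t =>
    Integrable.of_bound (hmeas t).aestronglyMeasurable _ (ae_of_all _ (hbd t))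
  simp only [h.value_eq Ω hW hm]
  rw [← integral_tsum_of_summable_integral_norm hint]
  · simp only [integral_const_mul]
  · refine (summable_returnConst (b := b) (B := B) (A := A) hW).of_nonneg_of_le
      (fun t => integral_nonneg fun x => norm_nonneg _) fun t => ?_
    have h1 : ‖∫ x, ‖S.γ ^ t * S.rewardAt Ω m t x‖ ∂ν‖ ≤ _ :=
      norm_integral_le_of_norm_le_const (ae_of_all _ fun x => (norm_norm _).trans_le (hbd t x))
    rw [probReal_univ, mul_one] at h1
    exact (le_abs_self _).trans h1

omit [DiscreteMeasurableSpace A] in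
lemma Bounds.summable_discounted_futureReward (h : S.Bounds b B) (hγ : S.γ < 1) (x : X) (a : A) :
    Summable fun k => S.γ ^ k * S.futureReward Ω m k x a :=
  ((summable_geometric_of_lt_one S.γ_nonneg hγ).mul_right b).of_norm_bounded fun k => by
    rw [norm_mul, Real.norm_eq_abs, Real.norm_eq_abs, abs_of_nonneg (pow_nonneg S.γ_nonneg k)]
    exact mul_le_mul_of_nonneg_left (h.abs_futureReward_le Ω m k x a) (pow_nonneg S.γ_nonneg k)

/-- The term k = 0 is the immediate reward; the others are γ times the discounted rewards seen from
the next state. -/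
lemma Bounds.hasSum_actionValue (h : S.Bounds b B) (hW : S.WeightBound W) (hγ : S.γ < 1)
    (hm : S.horizon m = ⊤) (x : X) (a : A) :
    HasSum (fun k => S.γ ^ k * S.futureReward Ω m k x a) (S.actionValue Ω m x a) := by
  have hs := h.summable_discounted_futureReward Ω (m := m) hγ x a
  convert hs.hasSum using 1
  rw [hs.tsum_eq_zero_add, actionValue, h.integral_value Ω hW hm, ← tsum_mul_left]
  simp only [futureReward_succ, pow_succ', mul_assoc, futureReward_zero, pow_zero, one_mul]

lemma Bounds.hasSum_policyGradTerm (h : S.Bounds b B) (hW : S.WeightBound W) (hγ : S.γ < 1)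
    (hm : S.horizon m = ⊤) (x : X) :
    HasSum (fun k => S.γ ^ k • S.gradTerm Ω m k x)
      (S.policyGradTerm Ω (S.actionValue Ω) m x) := by
  have h1 := hasSum_sum (s := Finset.univ) fun (a : A) _ =>
    (h.hasSum_actionValue Ω hW hγ hm x a).smul_const (∇ (fun Ω' => S.policy Ω' m x a) Ω)
  unfold policyGradTerm gradTerm
  simpa only [Finset.smul_sum, smul_smul] using h1

omit [DiscreteMeasurableSpace A] in
lemma Bounds.norm_discounted_gradTerm_le (h : S.Bounds b B) (k : ℕ) (x : X) :
    ‖S.γ ^ k • S.gradTerm Ω m k x‖ ≤ S.γ ^ k * (Fintype.card A * (b * B)) := by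
  rw [norm_smul, Real.norm_eq_abs, abs_of_nonneg (pow_nonneg S.γ_nonneg k)]
  exact mul_le_mul_of_nonneg_left (h.norm_gradTerm_le Ω m k x) (pow_nonneg S.γ_nonneg k)

lemma Bounds.norm_policyGradTerm_le (h : S.Bounds b B) (hW : S.WeightBound W) (hγ : S.γ < 1)
    (hm : S.horizon m = ⊤) (x : X) :
    ‖S.policyGradTerm Ω (S.actionValue Ω) m x‖ ≤
      ∑' k, S.γ ^ k * (Fintype.card A * (b * B)) := by
  rw [← (h.hasSum_policyGradTerm Ω hW hγ hm x).tsum_eq]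
  exact tsum_of_norm_bounded
    ((summable_geometric_of_lt_one S.γ_nonneg hγ).mul_right _).hasSum
    fun k => h.norm_discounted_gradTerm_le Ω k x

lemma Bounds.stronglyMeasurable_policyGradTerm (h : S.Bounds b B) (hW : S.WeightBound W)
    (hγ : S.γ < 1) (hm : S.horizon m = ⊤) :
    StronglyMeasurable (S.policyGradTerm Ω (S.actionValue Ω) m) := by
  refine stronglyMeasurable_of_tendsto atTop
    (f := fun (n : ℕ) x => ∑ k ∈ Finset.range n, S.γ ^ k • S.gradTerm Ω m k x)
    (fun n => Finset.stronglyMeasurable_fun_sum _ fun k _ =>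
      (stronglyMeasurable_gradTerm Ω m k).fun_const_smul _) ?_
  rw [tendsto_pi_nhds]
  exact fun x => (h.hasSum_policyGradTerm Ω hW hγ hm x).tendsto_sum_nat

lemma Bounds.integral_policyGradTerm (h : S.Bounds b B) (hW : S.WeightBound W)
    (hγ : S.γ < 1) (hm : S.horizon m = ⊤) (ν : Measure X) [IsProbabilityMeasure ν] :
    ∫ x, S.policyGradTerm Ω (S.actionValue Ω) m x ∂ν =
      ∑' k, S.γ ^ k • ∫ x, S.gradTerm Ω m k x ∂ν := by
  have hint : ∀ k, Integrable (fun x => S.γ ^ k • S.gradTerm Ω m k x) ν := fun k =>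
    Integrable.of_bound ((stronglyMeasurable_gradTerm Ω m k).fun_const_smul _).aestronglyMeasurable _
      (ae_of_all _ (h.norm_discounted_gradTerm_le Ω k))
  simp only [← (h.hasSum_policyGradTerm Ω hW hγ hm _).tsum_eq]
  rw [← integral_tsum_of_summable_integral_norm hint]
  · simp only [integral_smul]
  · refine ((summable_geometric_of_lt_one S.γ_nonneg hγ).mul_right
      (Fintype.card A * (b * B))).of_nonneg_of_le
      (fun t => integral_nonneg fun x => norm_nonneg _) fun k => ?_
    have h1 : ‖∫ x, ‖S.γ ^ k • S.gradTerm Ω m k x‖ ∂ν‖ ≤ _ :=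
      norm_integral_le_of_norm_le_const
        (ae_of_all _ fun x => (norm_norm _).trans_le (h.norm_discounted_gradTerm_le Ω k x))
    rw [probReal_univ, mul_one] at h1
    exact (le_abs_self _).trans h1

omit [DiscreteMeasurableSpace A] in
lemma occupancy_eq (m : M) : S.occupancy Ω m = Measure.sum fun t : ℕ =>
    ENNReal.ofReal (S.γ ^ t) • S.stateLaw Ω m (S.init m) t := rfl

omit [DiscreteMeasurableSpace A] in
lemma isFiniteMeasure_occupancy (hγ : S.γ < 1) (m : M) : IsFiniteMeasure (S.occupancy Ω m) := by
  refine ⟨?_⟩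
  rw [occupancy_eq, Measure.sum_apply _ MeasurableSet.univ]
  simp only [Measure.smul_apply, measure_univ, smul_eq_mul, mul_one]
  exact (summable_geometric_of_lt_one S.γ_nonneg hγ).tsum_ofReal_lt_top

lemma Bounds.integrable_policyGradTerm (h : S.Bounds b B) (hW : S.WeightBound W)
    (hγ : S.γ < 1) (hm : S.horizon m = ⊤) :
    Integrable (S.policyGradTerm Ω (S.actionValue Ω) m) (S.occupancy Ω m) := by
  have := isFiniteMeasure_occupancy (S := S) Ω hγ m
  exact Integrable.of_bound (h.stronglyMeasurable_policyGradTerm Ω hW hγ hm).aestronglyMeasurable _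
    (ae_of_all _ (h.norm_policyGradTerm_le Ω hW hγ hm))

/-- The policy gradient theorem for one task with infinite horizon. -/
lemma Bounds.integral_occupancy_policyGradTerm (h : S.Bounds b B) (hW : S.WeightBound W)
    (hγ : S.γ < 1) (hm : S.horizon m = ⊤) :
    ∫ x, S.policyGradTerm Ω (S.actionValue Ω) m x ∂S.occupancy Ω m =
      ∇ (fun Ω' => S.expReturn Ω' m) Ω := by
  have hint := h.integrable_policyGradTerm Ω hW hγ hm
  have hI : ∀ k j, ‖∫ x, S.gradTerm Ω m k x ∂S.stateLaw Ω m (S.init m) j‖ ≤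
      Fintype.card A * (b * B) := fun k j => by
    simpa using norm_integral_le_of_norm_le_const (μ := S.stateLaw Ω m (S.init m) j)
      (ae_of_all _ (h.norm_gradTerm_le Ω m k))
  rw [h.gradient_expReturn hW]
  rw [occupancy_eq] at hint ⊢
  simp only [weight_of_horizon_eq_top hm]
  rw [integral_sum_measure hint, ← tsum_geometric_antidiagonal S.γ_nonneg hγ hI]
  refine tsum_congr fun j => ?_
  rw [integral_smul_measure, ENNReal.toReal_ofReal (pow_nonneg S.γ_nonneg j),
    h.integral_policyGradTerm Ω hW hγ hm]

end InfiniteHorizon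

variable [DiscreteMeasurableSpace A] (μ : Measure M) [IsProbabilityMeasure μ]

/-- A compatible function approximator yields the exact gradient of the objective. -/
lemma Bounds.occSum_of_isCompatibleFit (h : S.Bounds b B) (hW : S.WeightBound W) (hγ : S.γ < 1)
    (hH : ∀ m, S.horizon m = ⊤) {Ω : Param d z K} {f : Param d z K → M → X → A → ℝ}
    {w : Param d z K} (hf : S.IsCompatibleFit μ Ω f w) :
    S.occSum μ Ω (S.policyGradTerm Ω (f w)) = ∇ (S.objective μ) Ω := by
  -- Compatibility cancels the factor π against 1/π, so the stationarity integrand becomes the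
  -- difference of the policy gradient integrands for Q and for the approximator.
  have hdiff : (fun m x => ∑ a, (S.policy Ω m x a * (S.actionValue Ω m x a - f w m x a)) •
      ∇ (fun w' => f w' m x a) w) = fun m x => S.policyGradTerm Ω (S.actionValue Ω) m x -
        S.policyGradTerm Ω (f w) m x := by
    funext m x
    unfold policyGradTerm
    rw [← Finset.sum_sub_distrib]
    refine Finset.sum_congr rfl fun a _ => ?_
    rw [(hf.compatible m x a).gradient, smul_smul, mul_right_comm,
      mul_inv_cancel₀ (S.policy_pos Ω m x a).ne', one_mul, sub_smul]
  have hstat := hf.stationary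
  obtain ⟨hin, hout⟩ := hf.integrable
  rw [hdiff, occSum] at hstat
  have hsplit : (fun m => ∫ x, (S.policyGradTerm Ω (S.actionValue Ω) m x -
      S.policyGradTerm Ω (f w) m x) ∂S.occupancy Ω m) =ᵐ[μ] fun m =>
        ∇ (fun Ω' => S.expReturn Ω' m) Ω -
          ∫ x, S.policyGradTerm Ω (f w) m x ∂S.occupancy Ω m := by
    filter_upwards [hin] with m hm
    rw [integral_sub (h.integrable_policyGradTerm Ω hW hγ (hH m)) hm,
      h.integral_occupancy_policyGradTerm Ω hW hγ (hH m)]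
  rw [integral_congr_ae hsplit, integral_sub (h.integrable_gradient_expReturn μ hW Ω) hout,
    sub_eq_zero] at hstat
  rw [h.gradient_objective μ hW, hstat, occSum]

lemma Bounds.eq_gradient_of_isUpdateDirection (h : S.Bounds b B) (hW : S.WeightBound W)
    (hH : S.γ < 1 ∨ ∃ N : ℕ, ∀ m, S.horizon m ≤ (N : ℕ∞)) {Ω G : Param d z K}
    (hG : S.IsUpdateDirection μ Ω G) : G = ∇ (S.objective μ) Ω := by
  cases hG with
  | exact => rfl
  | likelihoodRatio hG => exact h.asapGradient_eq Ω hW μ hG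
  | approx htop f w hf =>
    -- Infinite horizons exclude the bounded-horizon alternative, as a probability space has at
    -- least one task; hence γ < 1.
    refine h.occSum_of_isCompatibleFit μ hW (hH.resolve_right ?_) htop hf
    rintro ⟨N, hN⟩
    obtain ⟨m⟩ : Nonempty M := Measure.nonempty_of_neZero μ
    have h1 := hN m
    rw [htop m, top_le_iff] at h1
    exact ENat.natCast_ne_top N h1

end Model

end ASAP

end

/-! ### Convergence of ASAP. -/

theorem mainTheorem1 {M X A : Type*} [MeasurableSpace M] [MeasurableSpace X] [MeasurableSpace A]
    [Fintype A] [Nonempty A] [DiscreteMeasurableSpace A] {d z K : ℕ}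
    (S : ASAP.Model M X A d z K) (μ : Measure M) [IsProbabilityMeasure μ]
    (hH : S.γ < 1 ∨ ∃ N : ℕ, ∀ m, S.horizon m ≤ (N : ℕ∞))
    (hreward : ∃ b : ℝ, ∀ m x a, |S.reward m x a| ≤ b)
    (hpolicy : ∃ B : ℝ, ∀ (Ω : ASAP.Param d z K) (m : M) (x : X) (a : A),
      ‖iteratedFDeriv ℝ 2 (fun Ω' => S.policy Ω' m x a) Ω‖ ≤ B)
    (η : ℕ → ℝ) (hη_nonneg : ∀ k, 0 ≤ η k) (hη_lim : Tendsto η atTop (𝓝 0))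
    (hη_sum : Tendsto (fun n => ∑ k ∈ Finset.range n, η k) atTop atTop)
    {Sample : Type*} [MeasurableSpace Sample] (Pr : Measure Sample) [IsProbabilityMeasure Pr]
    (Ω : ℕ → Sample → ASAP.Param d z K)
    (hupdate : ∀ k, ∀ᵐ ω ∂Pr, ∃ G : ASAP.Param d z K, S.IsUpdateDirection μ (Ω k ω) G ∧
      Ω (k + 1) ω = Ω k ω + η k • G) :
    Differentiable ℝ (S.objective μ) ∧
      ∀ᵐ ω ∂Pr, (∃ l : ℝ, Tendsto (fun k => S.objective μ (Ω k ω)) atTop (𝓝 l)) ∧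
        Tendsto (fun k => ∇ (S.objective μ) (Ω k ω)) atTop (𝓝 0) := by
  obtain ⟨b, hb⟩ := hreward
  obtain ⟨B, hB⟩ := hpolicy
  -- The maximum secures a nonnegative bound, and the added 1 comes from bounding the gradient of a
  -- [0,1]-valued function.
  have h : S.Bounds b (1 + max B 0) := ⟨hb, fun m x a =>
    S.isC11_policy (le_max_right _ _) fun Ω => (hB Ω m x a).trans (le_max_left _ _)⟩
  obtain ⟨W, hW⟩ := S.exists_weightBound hH
  have hC := h.isC11_objective μ hW
  refine ⟨hC.differentiable, ?_⟩
  -- Countably many almost sure updates hold simultaneously; the rest of the argument is pathwise.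
  filter_upwards [ae_all_iff.2 hupdate] with ω hω
  refine ASAP.gradient_ascent_converges hC.nonneg₀ hC.differentiable
    (fun x => (le_abs_self _).trans (hC.abs_le x)) hC.gradient_lipschitz hη_nonneg hη_lim hη_sum
    fun k => ?_
  obtain ⟨G, hG, hk⟩ := hω k
  rw [hk, h.eq_gradient_of_isUpdateDirection μ hW hH hG]
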